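/- Let $d\ge 1$. Fix a smooth, radial, (radially) non-increasing function $\chi:\mathbb R^d\to\mathbb R$ supported in the ball of radius $4/3$ and equal to $1$ on the ball of radius $3/4$, both centred at $0$, and put $\varphi(\xi)=\chi(\xi/2)-\chi(\xi)$. For $u\in\mathcal S'(\mathbb R^d)$ and $j\in\mathbb Z$ let $$\dot S_ju=\mathcal F^{-1}\big(\chi(2^{-j}\cdot)\mathcal Fu\big),\qquad \dot\Delta_ju=\mathcal F^{-1}\big(\varphi(2^{-j}\cdot)\mathcal Fu\big),$$ where $\mathcal Fu(\xi)=\int e^{-2\pi i x\cdot\xi}u(x)\,dx$ for Schwartz functions. Let $\mathcal S'_0$ be the space of $u\in\mathcal S'(\mathbb R^d)$ with $\lim_{j\to-\infty}\|\dot S_ju\|_{L^\infty}=0$. For $s\in\mathbb R$ and $1\le p,r\le\infty$ let $\dot B^s_{p,r}$ be the space of $u\in\mathcal S'_0$ with $$\|u\|_{\dot B^s_{p,r}}:=\big\|\big(2^{js}\|\dot\Delta_ju\|_{L^p}\big)_{j}\big\|_{\ell^r(\mathbb Z)}<\infty .$$ The product of two tempered distributions $f,g$ is understood as $fg:=\lim_{N\to\infty}\dot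 S_Nf\,\dot S_Ng$ in $\mathcal S'(\mathbb R^d)$, where $\dot S_Nf$ and $\dot S_Ng$ are smooth functions and are multiplied pointwise, whenever this limit exists. **Proposition 5.1.** Let $s_1,s_2\in\mathbb R$ and $1\le p_1,p_2\le\infty$ be such that $$s_1+s_2\ge 0,\qquad s_1\le\frac d{p_1},\qquad s_2<\min\Big(\frac d{p_1},\frac d{p_2}\Big),\qquad \frac1{p_1}+\frac1{p_2}\le1 .$$ Then there is a constant $C$, depending only on $d,s_1,s_2,p_1,p_2$ and $\chi$, such that for all $f\in\dot B^{s_1}_{p_1,1}$ and $g\in\dot B^{s_2}_{p_2,\infty}$ the product $fg$ exists, belongs to $\dot B^{s_1+s_2-d/p_1}_{p_2,\infty}$, and satisfies $$\|fg\|_{\dot B^{s_1+s_2-\frac d{p_1}}_{p_2,\infty}}\le C\,\|f\|_{\dot B^{s_1}_{p_1,1}}\,\|g\|_{\dot B^{s_2}_{p_2,\infty}} .$$ -/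

import Mathlib

open MeasureTheory Filter Topology TemperedDistribution
open scoped ENNReal NNReal SchwartzMap

noncomputable section

namespace HomBesov

/-- The Euclidean space `ℝᵈ`. -/
abbrev Eu (d : ℕ) : Type := EuclideanSpace ℝ (Fin d)

/-- `χ` is an admissible Littlewood-Paley cutoff on `ℝᵈ`: smooth, radial, non-increasing along
rays, supported in the ball of radius `4/3` and equal to `1` on the ball of radius `3/4`. -/
structure IsCutoff {d : ℕ} (χ : Eu d → ℝ) : Prop where
  smooth : ContDiff ℝ (⊤ : ℕ∞) χ
  /-- Radial and non-increasing in `‖ξ‖` (taking `‖ξ‖ = ‖η‖` shows that `χ` is radial). -/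
  antitone : ∀ ξ η : Eu d, ‖ξ‖ ≤ ‖η‖ → χ η ≤ χ ξ
  support_subset : tsupport χ ⊆ Metric.closedBall 0 (4 / 3)
  eq_one : ∀ ξ ∈ Metric.ball (0 : Eu d) (3 / 4), χ ξ = 1

variable {d : ℕ}

/-- `φ(ξ) = χ(ξ/2) - χ(ξ)`. -/
def annulus (χ : Eu d → ℝ) (ξ : Eu d) : ℝ := χ ((2 : ℝ)⁻¹ • ξ) - χ ξ

/-- The low frequency cutoff `Ṡ_j u = 𝓕⁻¹(χ(2⁻ʲ ·) 𝓕 u)` of a tempered distribution. -/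
def lowFreq (χ : Eu d → ℝ) (j : ℤ) (u : 𝓢'(Eu d, ℂ)) : 𝓢'(Eu d, ℂ) :=
  fourierMultiplierCLM ℂ (fun ξ : Eu d => ((χ ((2 : ℝ) ^ (-j) • ξ) : ℝ) : ℂ)) u

/-- The homogeneous dyadic block `Δ̇_j u = 𝓕⁻¹(φ(2⁻ʲ ·) 𝓕 u)` of a tempered distribution. -/
def dyadicBlock (χ : Eu d → ℝ) (j : ℤ) (u : 𝓢'(Eu d, ℂ)) : 𝓢'(Eu d, ℂ) :=
  fourierMultiplierCLM ℂ (fun ξ : Eu d => ((annulus χ ((2 : ℝ) ^ (-j) • ξ) : ℝ) : ℂ)) u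

/-- The `Lᵖ` norm of a tempered distribution, with value `∞` if the distribution is not given by an
`Lᵖ` function (the infimum is over at most one element, `Lᵖ` being embedded in `𝓢'`). -/
def distLpNorm (p : ℝ≥0∞) [Fact (1 ≤ p)] (u : 𝓢'(Eu d, ℂ)) : ℝ≥0∞ :=
  ⨅ (F : Lp ℂ p (volume : Measure (Eu d))) (_ : (F : 𝓢'(Eu d, ℂ)) = u), ‖F‖ₑ

/-- The homogeneous Besov norm `‖(2^{js} ‖Δ̇_j u‖_{Lᵖ})_j‖_{ℓʳ(ℤ)}`, with values in `[0, ∞]`. -/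
def besovNorm (χ : Eu d → ℝ) (s : ℝ) (p r : ℝ≥0∞) [Fact (1 ≤ p)] (u : 𝓢'(Eu d, ℂ)) : ℝ≥0∞ :=
  eLpNorm (fun j : ℤ => (2 : ℝ≥0∞) ^ ((j : ℝ) * s) * distLpNorm p (dyadicBlock χ j u)) r Measure.count

/-- The space `S'_0` of tempered distributions with `‖Ṡ_j u‖_{L^∞} → 0` as `j → -∞`. -/
def VanishesAtLowFreq (χ : Eu d → ℝ) (u : 𝓢'(Eu d, ℂ)) : Prop :=
  Tendsto (fun j : ℤ => distLpNorm ∞ (lowFreq χ j u)) atBot (𝓝 0)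

/-- The homogeneous Besov space `Ḃ^s_{p,r}(ℝᵈ)`. -/
def besovSpace (χ : Eu d → ℝ) (s : ℝ) (p r : ℝ≥0∞) [Fact (1 ≤ p)] : Set 𝓢'(Eu d, ℂ) :=
  {u | VanishesAtLowFreq χ u ∧ besovNorm χ s p r u < ∞}

/-- `h` is the product `fg` of the tempered distributions `f` and `g`: the pointwise products of the
smooth functions `Ṡ_N f` and `Ṡ_N g` converge to `h` in `𝓢'` as `N → ∞`. (As `Ṡ_N f` is
band-limited, it is given by exactly one smooth function of temperate growth, called `F N` here,
so that `h` is unique if it exists.) -/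
def IsProduct (χ : Eu d → ℝ) (f g h : 𝓢'(Eu d, ℂ)) : Prop :=
  ∃ (F G : ℤ → Eu d → ℂ) (hF : ∀ N, (F N).HasTemperateGrowth)
    (hG : ∀ N, (G N).HasTemperateGrowth),
    (∀ N, Function.HasTemperateGrowth.toTemperedDistribution volume (hF N) = lowFreq χ N f) ∧
    (∀ N, Function.HasTemperateGrowth.toTemperedDistribution volume (hG N) = lowFreq χ N g) ∧
    Tendsto (fun N : ℤ => Function.HasTemperateGrowth.toTemperedDistribution volume
      ((hF N).mul (hG N))) atTop (𝓝 h)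

end HomBesov

end

/-! The partial products P_N = Ṡ_N f · Ṡ_N g are telescoped. With a_k = Δ̇_k f and b_k = Δ̇_k g,
Bony's decomposition writes P_{k+1} − P_k = W_k + D_k. Here W_k = Ṡ_{k−2}f · b_k + a_k · Ṡ_{k−2}g
has spectrum in an annulus of size 2^k, and D_k collects the five products a_i b_j with max(i, j) =
k and |i − j| ≤ 2 (`IsCutoff.exists_decomposition`).

Put σ = d/p₁ − s₁ − s₂ and 1/q = 1/p₁ + 1/p₂. Hölder and Bernstein give ‖W_k‖_{p₂} ≲ 2^{kσ}. The ℓ¹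
summability of f allows the endpoint s₁ = d/p₁, while the ℓ^∞ control of g requires the strict bound
on s₂. For D_k, Hölder in L^q pairs the ℓ¹ sum of f with the supremum over g. As s₁ + s₂ ≥ 0, this
yields ∑_{k≥j} ‖D_k‖_q ≲ 2^{−j(s₁+s₂)}.

The D_k are therefore absolutely summable in L^q for k ≥ 0. The W_k may grow, but being annular they
equal a fixed power of |ξ|² applied to blocks that are summable in L^{p₂}, so their series converges
in 𝓢' (`exists_tendsto_of_annular`). Hence the product h exists.

For the norm, Δ̇_j is applied to h = P_{j−2} + ∑_{k≥j−2}(W_k + D_k). The first term is killed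
because its frequencies are too low, only six of the W_k are seen, and Bernstein from L^q to L^{p₂}
costs 2^{jd/p₁} on the D_k; every remaining term is ≲ 2^{jσ} (`IsSymbol.exists_telescope_bound`).
The same argument with Ṡ_j and L^∞ gives ‖Ṡ_j h‖_∞ ≲ 2^{jε} with ε = d/p₁ + d/p₂ − s₁ − s₂ > 0, so h
lies in 𝓢'_0. -/

noncomputable section

namespace HomBesov

variable {d : ℕ}

/-! ### Young and interpolation inequalities for convolutions -/

section Convolution

/-- The convolution of a function with a kernel. -/
def kernelConv {V : Type*} [NormedAddCommGroup V] [NormedSpace ℂ V]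
    (K : Eu d → V) (F : Eu d → ℂ) (x : Eu d) : V :=
  ∫ y, F y • K (x - y)

theorem lintegral_comp_sub_left (k : Eu d → ℝ≥0∞) (x : Eu d) :
    ∫⁻ y, k (x - y) = ∫⁻ y, k y :=
  lintegral_sub_left_eq_self k x

/-- The weighted Jensen inequality behind Young's inequality. -/
theorem lintegral_kernel_mul_le (k : Eu d → ℝ≥0∞) (hk : Measurable k) {F : Eu d → ℂ}
    (hF : StronglyMeasurable F) {p : ℝ≥0∞} (hp : 1 ≤ p) (x : Eu d) :
    ∫⁻ y, ‖F y‖ₑ * k (x - y) ≤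
      eLpNorm F p (volume.withDensity fun y => k (x - y)) *
        (∫⁻ y, k y) ^ (1 - (p⁻¹).toReal) := by
  have hk' : Measurable fun y => k (x - y) := hk.comp (measurable_const.sub measurable_id)
  have h := eLpNorm_le_eLpNorm_mul_rpow_measure_univ (μ := volume.withDensity fun y => k (x - y))
    hp (f := F) hF.aestronglyMeasurable
  rw [eLpNorm_one_eq_lintegral_enorm, lintegral_withDensity_eq_lintegral_mul _ hk' hF.enorm,
    withDensity_apply _ MeasurableSet.univ, Measure.restrict_univ, lintegral_comp_sub_left] at h
  simpa [mul_comm, ENNReal.toReal_inv] using h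

/-- The weighted measure is at most `c` times Lebesgue measure. For p = ∞ the factor is c⁰ = 1, and
absolute continuity alone suffices. -/
theorem eLpNorm_withDensity_le (k : Eu d → ℝ≥0∞) {c : ℝ≥0∞} (hc : ∀ x, k x ≤ c) (F : Eu d → ℂ)
    {p : ℝ≥0∞} (hp : 1 ≤ p) (x : Eu d) :
    eLpNorm F p (volume.withDensity fun y => k (x - y)) ≤
      c ^ (p⁻¹).toReal * eLpNorm F p volume := by
  have hp0 : p ≠ 0 := (zero_lt_one.trans_le hp).ne'
  rcases eq_or_ne p ∞ with rfl | hpt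
  · simpa using eLpNormEssSup_mono_measure F (withDensity_absolutelyContinuous _ _)
  · have : (volume.withDensity fun y => k (x - y)) ≤ c • (volume : Measure (Eu d)) := by
      rw [← withDensity_const]
      exact withDensity_mono (Eventually.of_forall fun y => hc _)
    refine (eLpNorm_mono_measure F this).trans ?_
    rw [eLpNorm_smul_measure_of_ne_top hpt]
    simp [ENNReal.toReal_inv]

theorem lintegral_kernel_mul_le_sup (k : Eu d → ℝ≥0∞) (hk : Measurable k) {c : ℝ≥0∞}
    (hc : ∀ x, k x ≤ c) {F : Eu d → ℂ} (hF : StronglyMeasurable F) {p : ℝ≥0∞} (hp : 1 ≤ p)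
    (x : Eu d) :
    ∫⁻ y, ‖F y‖ₑ * k (x - y) ≤
      c ^ (p⁻¹).toReal * eLpNorm F p volume * (∫⁻ y, k y) ^ (1 - (p⁻¹).toReal) :=
  (lintegral_kernel_mul_le k hk hF hp x).trans
    (by gcongr; exact eLpNorm_withDensity_le k hc F hp x)

theorem toReal_inv_le_one {p : ℝ≥0∞} (hp : 1 ≤ p) : (p⁻¹).toReal ≤ 1 := by
  have := ENNReal.toReal_mono ENNReal.one_ne_top (ENNReal.inv_le_one.2 hp)
  simpa using this

variable {V : Type*} [NormedAddCommGroup V] [NormedSpace ℂ V]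

theorem enorm_kernelConv_le (K : Eu d → V) (F : Eu d → ℂ) (x : Eu d) :
    ‖kernelConv K F x‖ₑ ≤ ∫⁻ y, ‖F y‖ₑ * ‖K (x - y)‖ₑ := by
  refine (enorm_integral_le_lintegral_enorm _).trans (le_of_eq ?_)
  simp [enorm_smul]

theorem stronglyMeasurable_kernelConv {K : Eu d → V} (hK : Continuous K) {F : Eu d → ℂ}
    (hF : StronglyMeasurable F) : StronglyMeasurable (kernelConv K F) := by
  apply StronglyMeasurable.integral_prod_right (f := fun x y => F y • K (x - y))
  have hF2 : StronglyMeasurable fun z : Eu d × Eu d => F z.2 := hF.comp_measurable measurable_snd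
  have hK2 : StronglyMeasurable fun z : Eu d × Eu d => K (z.1 - z.2) :=
    (hK.comp (continuous_fst.sub continuous_snd)).stronglyMeasurable
  exact hF2.smul hK2

/-- The endpoint Lᵖ → L^∞: for a dilated kernel, with supremum of order 2^{jd} and bounded L¹ norm,
the factor is of order 2^{jd/p}. -/
theorem eLpNorm_kernelConv_top_le {K : Eu d → V} (hK : Continuous K) {c : ℝ≥0∞}
    (hc : ∀ x, ‖K x‖ₑ ≤ c) {F : Eu d → ℂ} (hF : StronglyMeasurable F) {p : ℝ≥0∞} (hp : 1 ≤ p) :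
    eLpNorm (kernelConv K F) ∞ volume ≤
      c ^ (p⁻¹).toReal * eLpNorm F p volume * (∫⁻ y, ‖K y‖ₑ) ^ (1 - (p⁻¹).toReal) := by
  rw [eLpNorm_exponent_top]
  refine eLpNormEssSup_le_of_ae_enorm_bound (Eventually.of_forall fun x => ?_)
  exact (enorm_kernelConv_le K F x).trans
    (lintegral_kernel_mul_le_sup (fun x => ‖K x‖ₑ) hK.enorm.measurable hc hF hp x)

/-- Young's inequality `L¹ * Lᵖ ⊆ Lᵖ`. -/
theorem eLpNorm_kernelConv_le {K : Eu d → V} (hK : Continuous K) {F : Eu d → ℂ}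
    (hF : StronglyMeasurable F) {p : ℝ≥0∞} (hp : 1 ≤ p) :
    eLpNorm (kernelConv K F) p volume ≤ (∫⁻ y, ‖K y‖ₑ) * eLpNorm F p volume := by
  have hk : Measurable fun x => ‖K x‖ₑ := hK.enorm.measurable
  have hp0 : p ≠ 0 := (zero_lt_one.trans_le hp).ne'
  rcases eq_or_ne p ∞ with rfl | hpt
  · rw [eLpNorm_exponent_top, mul_comm]
    refine eLpNormEssSup_le_of_ae_enorm_bound (Eventually.of_forall fun x => ?_)
    refine (enorm_kernelConv_le K F x).trans ?_
    refine (lintegral_kernel_mul_le (fun x => ‖K x‖ₑ) hk hF le_top x).trans ?_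
    simp only [ENNReal.inv_top, ENNReal.toReal_zero, sub_zero, ENNReal.rpow_one]
    refine mul_le_mul' ?_ le_rfl
    simpa using eLpNormEssSup_mono_measure F (withDensity_absolutelyContinuous _ _)
  have hp' : 1 ≤ p.toReal := by
    simpa using ENNReal.toReal_mono hpt hp
  have hpos : 0 < p.toReal := by linarith
  set k1 := ∫⁻ y, ‖K y‖ₑ with hk1
  -- Jensen for the measure |K(x − y)| dy; Tonelli in x then supplies the missing factor `k1`.
  have key : ∀ x, ‖kernelConv K F x‖ₑ ^ p.toReal ≤
      k1 ^ (p.toReal - 1) * ∫⁻ y, ‖K (x - y)‖ₑ * ‖F y‖ₑ ^ p.toReal := by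
    intro x
    have hk' : Measurable fun y => ‖K (x - y)‖ₑ := hk.comp (measurable_const.sub measurable_id)
    have h := (enorm_kernelConv_le K F x).trans
      (lintegral_kernel_mul_le (fun x => ‖K x‖ₑ) hk hF hp x)
    refine (ENNReal.rpow_le_rpow h hpos.le).trans (le_of_eq ?_)
    rw [eLpNorm_eq_lintegral_rpow_enorm_toReal hp0 hpt,
      lintegral_withDensity_eq_lintegral_mul _ hk' (hF.enorm.pow_const _),
      ENNReal.mul_rpow_of_nonneg _ _ hpos.le, ← ENNReal.rpow_mul, ← ENNReal.rpow_mul,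
      one_div, inv_mul_cancel₀ hpos.ne', ENNReal.rpow_one, mul_comm, ENNReal.toReal_inv]
    congr 2
    field_simp
  rw [eLpNorm_eq_lintegral_rpow_enorm_toReal hp0 hpt,
    eLpNorm_eq_lintegral_rpow_enorm_toReal hp0 hpt]
  have hmeas : Measurable fun z : Eu d × Eu d => ‖K (z.1 - z.2)‖ₑ * ‖F z.2‖ₑ ^ p.toReal :=
    (hk.comp (measurable_fst.sub measurable_snd)).mul
      ((hF.enorm.comp measurable_snd).pow_const _)
  have tot : ∫⁻ x, ‖kernelConv K F x‖ₑ ^ p.toReal ≤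
      k1 ^ p.toReal * ∫⁻ y, ‖F y‖ₑ ^ p.toReal := by
    calc ∫⁻ x, ‖kernelConv K F x‖ₑ ^ p.toReal
        ≤ ∫⁻ x, k1 ^ (p.toReal - 1) * ∫⁻ y, ‖K (x - y)‖ₑ * ‖F y‖ₑ ^ p.toReal :=
          lintegral_mono key
      _ = k1 ^ (p.toReal - 1) * ∫⁻ x, ∫⁻ y, ‖K (x - y)‖ₑ * ‖F y‖ₑ ^ p.toReal :=
          lintegral_const_mul _ hmeas.lintegral_prod_right'
      _ = k1 ^ (p.toReal - 1) * ∫⁻ y, ∫⁻ x, ‖K (x - y)‖ₑ * ‖F y‖ₑ ^ p.toReal := by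
          rw [lintegral_lintegral_swap hmeas.aemeasurable]
      _ = k1 ^ (p.toReal - 1) * ∫⁻ y, k1 * ‖F y‖ₑ ^ p.toReal := by
          congr 1
          refine lintegral_congr fun y => ?_
          have hky : Measurable fun x => ‖K (x - y)‖ₑ :=
            hk.comp (measurable_id.sub measurable_const)
          rw [lintegral_mul_const _ hky,
            lintegral_sub_right_eq_self (fun x => ‖K x‖ₑ) y]
      _ = k1 ^ p.toReal * ∫⁻ y, ‖F y‖ₑ ^ p.toReal := by
          rw [lintegral_const_mul _ (hF.enorm.pow_const _), ← mul_assoc]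
          congr 1
          nth_rewrite 2 [← ENNReal.rpow_one k1]
          rw [← ENNReal.rpow_add_of_nonneg _ _ (by linarith) zero_le_one]
          simp
  refine (ENNReal.rpow_le_rpow tot (by positivity)).trans (le_of_eq ?_)
  rw [ENNReal.mul_rpow_of_nonneg _ _ (by positivity), ← ENNReal.rpow_mul, mul_one_div_cancel hpos.ne',
    ENNReal.rpow_one]

/-- Interpolation between `Lᵖ` and `L^∞`. -/
theorem eLpNorm_le_interpolate {G : Eu d → ℂ} (hG : AEStronglyMeasurable G) {p q : ℝ≥0∞}
    (hp : 1 ≤ p) (hpq : p ≤ q) {a b : ℝ≥0∞} (ha : eLpNorm G p volume ≤ a)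
    (hb : eLpNorm G ∞ volume ≤ b) :
    eLpNorm G q volume ≤
      a ^ ((q⁻¹).toReal * (p⁻¹).toReal⁻¹) * b ^ (1 - (q⁻¹).toReal * (p⁻¹).toReal⁻¹) := by
  have hp0 : p ≠ 0 := (zero_lt_one.trans_le hp).ne'
  have hq0 : q ≠ 0 := (zero_lt_one.trans_le (hp.trans hpq)).ne'
  rcases eq_or_ne q ∞ with rfl | hqt
  · simpa using hb
  have hpt : p ≠ ∞ := ne_top_of_le_ne_top hqt hpq
  have hp' : 0 < p.toReal := ENNReal.toReal_pos hp0 hpt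
  have hq' : 0 < q.toReal := ENNReal.toReal_pos hq0 hqt
  have hpq' : p.toReal ≤ q.toReal := ENNReal.toReal_mono hqt hpq
  rw [eLpNorm_exponent_top] at hb
  have hb' : ∀ᵐ x, ‖G x‖ₑ ≤ b := (ae_le_eLpNormEssSup (f := G)).mono fun x hx => hx.trans hb
  have h1 : ∫⁻ x, ‖G x‖ₑ ^ q.toReal ≤ (∫⁻ x, ‖G x‖ₑ ^ p.toReal) * b ^ (q.toReal - p.toReal) := by
    rw [← lintegral_mul_const'' _ (hG.enorm.pow_const _)]
    refine lintegral_mono_ae (hb'.mono fun x hx => ?_)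
    have : q.toReal = p.toReal + (q.toReal - p.toReal) := by ring
    rw [this, ENNReal.rpow_add_of_nonneg _ _ hp'.le (by linarith)]
    simp only [add_sub_cancel_left]
    gcongr
  have h2 : ∫⁻ x, ‖G x‖ₑ ^ p.toReal ≤ a ^ p.toReal := by
    rw [eLpNorm_eq_lintegral_rpow_enorm_toReal hp0 hpt] at ha
    have := ENNReal.rpow_le_rpow ha hp'.le
    rwa [← ENNReal.rpow_mul, one_div_mul_cancel hp'.ne', ENNReal.rpow_one] at this
  rw [eLpNorm_eq_lintegral_rpow_enorm_toReal hq0 hqt]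
  calc (∫⁻ x, ‖G x‖ₑ ^ q.toReal) ^ (1 / q.toReal)
      ≤ (a ^ p.toReal * b ^ (q.toReal - p.toReal)) ^ (1 / q.toReal) := by
        gcongr
        exact h1.trans (by gcongr)
    _ = _ := by
        rw [ENNReal.mul_rpow_of_nonneg _ _ (by positivity), ← ENNReal.rpow_mul, ← ENNReal.rpow_mul,
          ENNReal.toReal_inv, ENNReal.toReal_inv]
        congr 2 <;> field_simp

end Convolution

/-! ### Smoothness of convolutions of bounded functions with Schwartz kernels -/

section Smoothness

universe u

variable {V : Type u} [NormedAddCommGroup V] [NormedSpace ℂ V]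

/-- The exponent d + 1 is chosen to make the majorant integrable on ℝᵈ. -/
theorem exists_norm_le_one_add_rpow (K : 𝓢(Eu d, V)) :
    ∃ C : ℝ, 0 ≤ C ∧ ∀ z, ‖K z‖ ≤ C * (1 + ‖z‖) ^ (-((d : ℝ) + 1)) := by
  refine ⟨2 ^ (d + 1) * ((Finset.Iic (d + 1, 0)).sup fun m => SchwartzMap.seminorm ℝ m.1 m.2) K,
    by positivity, fun z => ?_⟩
  have h := SchwartzMap.one_add_le_sup_seminorm_apply (𝕜 := ℝ) (m := (d + 1, 0)) (k := d + 1)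
    (n := 0) le_rfl le_rfl K z
  rw [norm_iteratedFDeriv_zero] at h
  have hz : 0 < 1 + ‖z‖ := by positivity
  rw [Real.rpow_neg hz.le, ← div_eq_mul_inv, le_div_iff₀ (by positivity), mul_comm]
  exact_mod_cast h

theorem integrable_kernel (c : Eu d) :
    Integrable fun y : Eu d => (1 + ‖c - y‖) ^ (-((d : ℝ) + 1)) := by
  have : Integrable fun y : Eu d => (1 + ‖y‖) ^ (-((d : ℝ) + 1)) :=
    integrable_one_add_norm (by simp)
  exact this.comp_sub_left c

variable {F : Eu d → ℂ} {B : ℝ}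

theorem integrable_kernelConv (hF : StronglyMeasurable F) (hB : ∀ᵐ y, ‖F y‖ ≤ B)
    (K : 𝓢(Eu d, V)) (x : Eu d) : Integrable fun y => F y • K (x - y) := by
  have hK : Integrable fun y => K (x - y) := K.integrable.comp_sub_left x
  exact hK.bdd_smul _ hF.aestronglyMeasurable hB

theorem exists_norm_kernelConv_le (hB : ∀ᵐ y, ‖F y‖ ≤ B)
    (K : 𝓢(Eu d, V)) : ∃ C, ∀ x, ‖kernelConv K F x‖ ≤ C := by
  refine ⟨B * ∫ y, ‖K y‖, fun x => ?_⟩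
  have hK : Integrable fun y => ‖K (x - y)‖ := (K.integrable.comp_sub_left x).norm
  refine (norm_integral_le_of_norm_le (hK.const_mul B) (hB.mono fun y hy => ?_)).trans ?_
  · rw [norm_smul]; gcongr
  · rw [integral_const_mul, integral_sub_left_eq_self (fun y => ‖K y‖) volume x]

/-- Differentiation under the integral. The derivative is again a convolution with a Schwartz
kernel, now with values in a space of linear maps, which is why kernels are vector-valued. -/
theorem hasFDerivAt_kernelConv (hF : StronglyMeasurable F) (hB : ∀ᵐ y, ‖F y‖ ≤ B)
    (K : 𝓢(Eu d, V)) (x : Eu d) :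
    HasFDerivAt (kernelConv K F) (kernelConv (SchwartzMap.fderivCLM ℝ (Eu d) V K) F x) x := by
  set K' := SchwartzMap.fderivCLM ℝ (Eu d) V K
  obtain ⟨C, hC0, hC⟩ := exists_norm_le_one_add_rpow K'
  refine hasFDerivAt_integral_of_dominated_of_fderiv_le
    -- The factor 2^{d+1} makes the majorant uniform for z in the unit ball around x, where 1 + |x −
    -- y| ≤ 2(1 + |z − y|).
    (bound := fun y => B * (C * 2 ^ ((d : ℝ) + 1) * (1 + ‖x - y‖) ^ (-((d : ℝ) + 1))))
    (F' := fun x y => F y • K' (x - y)) (Metric.ball_mem_nhds x one_pos) ?_ ?_ ?_ ?_ ?_ ?_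
  · exact Eventually.of_forall fun z => (integrable_kernelConv hF hB K z).aestronglyMeasurable
  · exact integrable_kernelConv hF hB K x
  · exact (integrable_kernelConv hF hB K' x).aestronglyMeasurable
  · refine hB.mono fun y hy z hz => ?_
    rw [norm_smul]
    gcongr
    · exact (norm_nonneg _).trans hy
    refine (hC _).trans ?_
    rw [mul_assoc]
    gcongr
    have h1 : ‖x - y‖ ≤ 1 + ‖z - y‖ := by
      have : ‖x - y‖ ≤ ‖x - z‖ + ‖z - y‖ := norm_sub_le_norm_sub_add_norm_sub _ _ _
      have h2 : ‖x - z‖ < 1 := by rwa [← dist_eq_norm, dist_comm]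
      linarith
    have h3 : 0 < 1 + ‖z - y‖ := by positivity
    have h4 : 0 < 1 + ‖x - y‖ := by positivity
    rw [Real.rpow_neg h3.le, Real.rpow_neg h4.le, ← div_eq_mul_inv,
      le_div_iff₀ (by positivity), inv_mul_le_iff₀ (by positivity),
      ← Real.mul_rpow h3.le (by norm_num)]
    gcongr
    linarith [norm_nonneg (z - y)]
  · exact (((integrable_kernel x).const_mul _).const_mul B)
  · refine Eventually.of_forall fun y z _ => ?_
    have := (K.differentiableAt (x := z - y)).hasFDerivAt
    exact (this.comp z ((hasFDerivAt_id z).sub_const y)).const_smul (F y)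

/-- The induction must quantify over the target space, since each derivative changes it; the
universe stays the same. -/
theorem contDiff_kernelConv (hF : StronglyMeasurable F) (hB : ∀ᵐ y, ‖F y‖ ≤ B) (n : ℕ) :
    ∀ {V : Type u} [NormedAddCommGroup V] [NormedSpace ℂ V] (K : 𝓢(Eu d, V)),
      ContDiff ℝ n (kernelConv K F) ∧
        ∃ C, ∀ x, ‖iteratedFDeriv ℝ n (kernelConv K F) x‖ ≤ C := by
  induction n with
  | zero =>
    intro V _ _ K
    refine ⟨?_, ?_⟩
    · exact contDiff_zero.2 (continuous_iff_continuousAt.2 fun x =>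
        (hasFDerivAt_kernelConv hF hB K x).continuousAt)
    · obtain ⟨C, hC⟩ := exists_norm_kernelConv_le hB K
      exact ⟨C, fun x => by rw [norm_iteratedFDeriv_zero]; exact hC x⟩
  | succ n ih =>
    intro V _ _ K
    have hd : fderiv ℝ (kernelConv K F) = kernelConv (SchwartzMap.fderivCLM ℝ (Eu d) V K) F :=
      funext fun x => (hasFDerivAt_kernelConv hF hB K x).fderiv
    obtain ⟨h1, C, hC⟩ := ih (SchwartzMap.fderivCLM ℝ (Eu d) V K)
    refine ⟨?_, C, fun x => ?_⟩
    · rw [Nat.cast_succ, contDiff_succ_iff_fderiv]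
      refine ⟨fun x => (hasFDerivAt_kernelConv hF hB K x).differentiableAt, by simp, ?_⟩
      rw [hd]; exact h1
    · rw [← norm_iteratedFDeriv_fderiv, hd]; exact hC x

theorem hasTemperateGrowth_kernelConv (hF : StronglyMeasurable F) (hB : ∀ᵐ y, ‖F y‖ ≤ B)
    (K : 𝓢(Eu d, V)) : (kernelConv K F).HasTemperateGrowth := by
  refine ⟨contDiff_infty.2 fun n => (contDiff_kernelConv hF hB n K).1, fun n => ?_⟩
  obtain ⟨C, hC⟩ := (contDiff_kernelConv hF hB n K).2
  exact ⟨0, C, fun x => by simpa using hC x⟩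

end Smoothness

/-! ### Multiplier kernels and their dyadic scaling -/

section Kernel

/-- The functions `m(2⁻ʲ ·)`. -/
def dilate (m : Eu d → ℂ) (j : ℤ) (ξ : Eu d) : ℂ := m ((2 : ℝ) ^ (-j) • ξ)

/-- Smooth compactly supported symbols. -/
structure IsSymbol (m : Eu d → ℂ) : Prop where
  smooth : ContDiff ℝ (⊤ : ℕ∞) m
  hasCompactSupport : HasCompactSupport m

variable {m : Eu d → ℂ}

theorem IsSymbol.dilated (hm : IsSymbol m) (j : ℤ) : IsSymbol (dilate m j) where
  smooth := hm.smooth.comp (contDiff_const_smul _)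
  hasCompactSupport := hm.hasCompactSupport.comp_smul (by positivity)

theorem IsSymbol.hasTemperateGrowth (hm : IsSymbol m) : m.HasTemperateGrowth :=
  hm.hasCompactSupport.hasTemperateGrowth hm.smooth

/-- A smooth compactly supported symbol as a Schwartz function. -/
def IsSymbol.toSchwartz (hm : IsSymbol m) : 𝓢(Eu d, ℂ) :=
  hm.hasCompactSupport.toSchwartzMap hm.smooth

open FourierTransform in
/-- The convolution kernel of a Fourier multiplier. -/
def IsSymbol.kernel (hm : IsSymbol m) : 𝓢(Eu d, ℂ) := 𝓕⁻ hm.toSchwartz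

open FourierTransform in
theorem IsSymbol.kernel_apply (hm : IsSymbol m) (x : Eu d) :
    hm.kernel x = ∫ v, Real.fourierChar (inner ℝ v x) • m v := by
  rw [IsSymbol.kernel, SchwartzMap.fourierInv_coe, Real.fourierInv_eq]
  rfl

theorem IsSymbol.kernel_dilate (hm : IsSymbol m) (j : ℤ) (x : Eu d) :
    (hm.dilated j).kernel x = ((2 : ℝ) ^ j) ^ d • hm.kernel ((2 : ℝ) ^ j • x) := by
  rw [IsSymbol.kernel_apply, IsSymbol.kernel_apply]
  have h := Measure.integral_comp_smul (volume : Measure (Eu d))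
    (fun v => Real.fourierChar (inner ℝ v ((2 : ℝ) ^ j • x)) • m v) ((2 : ℝ) ^ (-j))
  rw [finrank_euclideanSpace_fin] at h
  have h2 : |(((2 : ℝ) ^ (-j)) ^ d)⁻¹| = ((2 : ℝ) ^ j) ^ d := by
    rw [abs_of_pos (by positivity), ← inv_pow, zpow_neg, inv_inv]
  rw [h2] at h
  rw [← h]
  refine integral_congr_ae (Eventually.of_forall fun v => ?_)
  simp only [dilate]
  rw [inner_smul_left, inner_smul_right, ← mul_assoc]
  have h3 : ((2 : ℝ) ^ j)⁻¹ * 2 ^ j = 1 := inv_mul_cancel₀ (by positivity)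
  simp [h3]

theorem IsSymbol.lintegral_kernel_dilate (hm : IsSymbol m) (j : ℤ) :
    ∫⁻ x, ‖(hm.dilated j).kernel x‖ₑ = ∫⁻ x, ‖hm.kernel x‖ₑ := by
  rw [← ofReal_integral_norm_eq_lintegral_enorm (SchwartzMap.integrable _),
    ← ofReal_integral_norm_eq_lintegral_enorm (SchwartzMap.integrable _)]
  congr 1
  simp_rw [hm.kernel_dilate j, norm_smul]
  rw [integral_const_mul, Measure.integral_comp_smul (volume : Measure (Eu d))
    (fun x => ‖hm.kernel x‖), finrank_euclideanSpace_fin, smul_eq_mul, ← mul_assoc,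
    abs_of_pos (by positivity), Real.norm_of_nonneg (by positivity), mul_inv_cancel₀ (by positivity),
    one_mul]

/-- Dilation preserves the L¹ norm of the kernel and multiplies its supremum by 2^{jd}. -/
theorem IsSymbol.exists_kernel_bound (hm : IsSymbol m) : ∃ C : ℝ≥0, 1 ≤ C ∧ ∀ j : ℤ,
    ∫⁻ x, ‖(hm.dilated j).kernel x‖ₑ ≤ C ∧
      ∀ x, ‖(hm.dilated j).kernel x‖ₑ ≤ C * (2 : ℝ≥0∞) ^ ((j : ℝ) * d) := by
  have h1 : ∫⁻ x, ‖hm.kernel x‖ₑ ≠ ∞ := hm.kernel.integrable.2.ne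
  lift (∫⁻ x, ‖hm.kernel x‖ₑ) to ℝ≥0 using h1 with a ha
  set b : ℝ≥0 := ⟨SchwartzMap.seminorm ℝ 0 0 hm.kernel, apply_nonneg _ _⟩ with hb
  refine ⟨max 1 (max a b), le_max_left _ _, fun j => ⟨?_, fun x => ?_⟩⟩
  · rw [hm.lintegral_kernel_dilate, ← ha]
    exact_mod_cast (le_max_left a b).trans (le_max_right _ _)
  · rw [hm.kernel_dilate, enorm_smul, mul_comm]
    gcongr
    · have : ‖hm.kernel ((2 : ℝ) ^ j • x)‖ₑ ≤ b := by
        rw [enorm_le_coe, ← NNReal.coe_le_coe]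
        exact SchwartzMap.norm_le_seminorm ℝ _ _
      refine this.trans ?_
      exact_mod_cast (le_max_right a b).trans (le_max_right _ _)
    · rw [ENNReal.rpow_mul, ENNReal.rpow_natCast, ENNReal.rpow_intCast, enorm_pow]
      gcongr
      rw [Real.enorm_of_nonneg (by positivity), ← Real.rpow_intCast, ← ENNReal.rpow_intCast,
        ← ENNReal.ofReal_rpow_of_pos (by norm_num)]
      simp

end Kernel

/-! ### Fourier multipliers as convolution operators on Lᵖ -/

section Representation

variable {m : Eu d → ℂ}

open FourierTransform in
-- The Fourier integral is moved from ψ onto the symbol by Fubini. The pairing is the negated inner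
-- product, because an inverse transform is being transposed.
theorem IsSymbol.fourier_smul_fourierInv_apply (hm : IsSymbol m) (ψ : 𝓢(Eu d, ℂ)) (y : Eu d) :
    𝓕 (SchwartzMap.smulLeftCLM ℂ m (𝓕⁻ ψ)) y = ∫ x, ψ x * hm.kernel (x - y) := by
  have hh : Integrable fun v : Eu d => Real.fourierChar (-inner ℝ v y) • m v :=
    (Real.fourierIntegral_convergent_iff (f := m) y).2 hm.toSchwartz.integrable
  have h := VectorFourier.integral_fourierIntegral_smul_eq_flip (L := -innerₗ (Eu d))
    (μ := volume) (ν := volume) Real.continuous_fourierChar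
    (by simpa using! continuous_inner.neg) ψ.integrable hh
  rw [SchwartzMap.fourier_coe, Real.fourier_eq]
  calc _ = ∫ v, 𝓕⁻ (ψ : Eu d → ℂ) v • (Real.fourierChar (-inner ℝ v y) • m v) := by
        refine integral_congr_ae (Eventually.of_forall fun v => ?_)
        simp only
        rw [SchwartzMap.smulLeftCLM_apply_apply hm.hasTemperateGrowth, SchwartzMap.fourierInv_coe,
          smul_comm, smul_eq_mul, smul_eq_mul, mul_smul_comm, mul_smul_comm, mul_comm]
    _ = _ := by
        refine Eq.trans ?_ (h.trans ?_)
        · rfl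
        · refine integral_congr_ae (Eventually.of_forall fun x => ?_)
          simp only [smul_eq_mul]
          rw [hm.kernel_apply]
          congr 1
          refine integral_congr_ae (Eventually.of_forall fun v => ?_)
          simp only [LinearMap.flip_apply, LinearMap.neg_apply, neg_neg, innerₗ_apply_apply]
          rw [← mul_smul, ← AddChar.map_add_eq_mul, inner_sub_right, real_inner_comm x v,
            sub_eq_add_neg]

/-- This justifies Fubini below: the y-integral is bounded uniformly in x, and ψ is integrable. -/
theorem IsSymbol.integrable_prod (hm : IsSymbol m) (ψ : 𝓢(Eu d, ℂ)) {p : ℝ≥0∞} (hp : 1 ≤ p)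
    {F : Eu d → ℂ} (hFm : StronglyMeasurable F) (hF : eLpNorm F p volume ≠ ∞) :
    Integrable (Function.uncurry fun x y => ψ x * (F y * hm.kernel (x - y)))
      (volume.prod volume) := by
  have hmeas : StronglyMeasurable
      (Function.uncurry fun x y : Eu d => ψ x * (F y * hm.kernel (x - y))) := by
    have h1 : StronglyMeasurable fun z : Eu d × Eu d => ψ z.1 :=
      (ψ.continuous.comp continuous_fst).stronglyMeasurable
    have h2 : StronglyMeasurable fun z : Eu d × Eu d => hm.kernel (z.1 - z.2) :=
      (hm.kernel.continuous.comp (continuous_fst.sub continuous_snd)).stronglyMeasurable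
    exact h1.mul ((hFm.comp_measurable measurable_snd).mul h2)
  refine ⟨hmeas.aestronglyMeasurable, ?_⟩
  rw [hasFiniteIntegral_iff_enorm, lintegral_prod _ hmeas.enorm.aemeasurable]
  obtain ⟨C, -, hC⟩ := hm.exists_kernel_bound
  have hK : ∀ x, ‖hm.kernel x‖ₑ ≤
      ENNReal.ofReal (SchwartzMap.seminorm ℝ 0 0 hm.kernel) := fun x => by
    rw [← ofReal_norm]
    exact ENNReal.ofReal_le_ofReal (SchwartzMap.norm_le_seminorm ℝ _ _)
  have hbd := fun x => lintegral_kernel_mul_le_sup (fun x => ‖hm.kernel x‖ₑ)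
    hm.kernel.continuous.enorm.measurable hK hFm hp x
  set M := ENNReal.ofReal (SchwartzMap.seminorm ℝ 0 0 hm.kernel) ^ (p⁻¹).toReal *
    eLpNorm F p volume * (∫⁻ y, ‖hm.kernel y‖ₑ) ^ (1 - (p⁻¹).toReal)
  have hM : M ≠ ∞ := by
    refine ENNReal.mul_ne_top (ENNReal.mul_ne_top ?_ hF) ?_
    · exact ENNReal.rpow_ne_top_of_nonneg ENNReal.toReal_nonneg ENNReal.ofReal_ne_top
    · exact ENNReal.rpow_ne_top_of_nonneg (by linarith [toReal_inv_le_one hp])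
        hm.kernel.integrable.2.ne
  calc ∫⁻ x, ∫⁻ y, ‖Function.uncurry (fun x y => ψ x * (F y * hm.kernel (x - y))) (x, y)‖ₑ
      ≤ ∫⁻ x, ‖ψ x‖ₑ * M := by
        refine lintegral_mono fun x => ?_
        simp only [Function.uncurry_apply_pair, enorm_mul]
        rw [lintegral_const_mul' _ _ enorm_ne_top]
        gcongr
        exact hbd x
    _ = (∫⁻ x, ‖ψ x‖ₑ) * M := lintegral_mul_const' _ _ hM
    _ < ∞ := ENNReal.mul_lt_top ψ.integrable.2 hM.lt_top

/-- A Fourier multiplier acts on `Lᵖ` functions by convolution with its kernel. -/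
theorem IsSymbol.fourierMultiplier_apply_Lp (hm : IsSymbol m) {p : ℝ≥0∞} [hp : Fact (1 ≤ p)]
    (F : Lp ℂ p (volume : Measure (Eu d))) (ψ : 𝓢(Eu d, ℂ)) :
    fourierMultiplierCLM ℂ m (F : 𝓢'(Eu d, ℂ)) ψ = ∫ x, ψ x • kernelConv hm.kernel F x := by
  have hint := hm.integrable_prod ψ hp.out (Lp.stronglyMeasurable F) (Lp.eLpNorm_ne_top F)
  rw [fourierMultiplierCLM_apply_apply, Lp.toTemperedDistribution_apply]
  simp_rw [hm.fourier_smul_fourierInv_apply]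
  calc _ = ∫ y, ∫ x, ψ x * (F y * hm.kernel (x - y)) := by
        refine integral_congr_ae (Eventually.of_forall fun y => ?_)
        simp only
        rw [smul_eq_mul, ← integral_mul_const]
        refine integral_congr_ae (Eventually.of_forall fun x => ?_)
        simp only
        ring
    _ = ∫ x, ∫ y, ψ x * (F y * hm.kernel (x - y)) := (integral_integral_swap hint).symm
    _ = _ := by
        refine integral_congr_ae (Eventually.of_forall fun x => ?_)
        simp only [kernelConv, smul_eq_mul]
        rw [integral_const_mul]

/-- Interpolation between Lᵖ → Lᵖ with factor C and Lᵖ → L^∞ with factor C 2^{jd/p}. -/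
theorem IsSymbol.exists_eLpNorm_kernelConv_le (hm : IsSymbol m) : ∃ C : ℝ≥0, 1 ≤ C ∧
    ∀ (p q : ℝ≥0∞), 1 ≤ p → p ≤ q → ∀ (j : ℤ) (F : Eu d → ℂ), StronglyMeasurable F →
      eLpNorm (kernelConv (hm.dilated j).kernel F) q volume ≤
        C * (2 : ℝ≥0∞) ^ ((j : ℝ) * (d * ((p⁻¹).toReal - (q⁻¹).toReal))) * eLpNorm F p volume := by
  obtain ⟨C, hC1, hC⟩ := hm.exists_kernel_bound
  refine ⟨C, hC1, fun p q hp hpq j F hF => ?_⟩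
  obtain ⟨h1, h2⟩ := hC j
  set K := (hm.dilated j).kernel
  set N := eLpNorm F p volume
  set P := (p⁻¹).toReal with hP
  set Q := (q⁻¹).toReal with hQ
  have hP1 : P ≤ 1 := toReal_inv_le_one hp
  have hP0 : 0 ≤ P := ENNReal.toReal_nonneg
  have hQ0 : 0 ≤ Q := ENNReal.toReal_nonneg
  have hQP : Q ≤ P := ENNReal.toReal_mono
    (ENNReal.inv_ne_top.2 (zero_lt_one.trans_le hp).ne') (ENNReal.inv_le_inv.2 hpq)
  have ha : eLpNorm (kernelConv K F) p volume ≤ C * N :=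
    (eLpNorm_kernelConv_le K.continuous hF hp).trans (by gcongr)
  have hb : eLpNorm (kernelConv K F) ∞ volume ≤ C * N * (2 : ℝ≥0∞) ^ ((j : ℝ) * d * P) := by
    refine (eLpNorm_kernelConv_top_le K.continuous h2 hF hp).trans ?_
    have : (∫⁻ y, ‖K y‖ₑ) ^ (1 - P) ≤ (C : ℝ≥0∞) ^ (1 - P) :=
      ENNReal.rpow_le_rpow h1 (by linarith)
    refine (mul_le_mul' le_rfl this).trans (le_of_eq ?_)
    rw [ENNReal.mul_rpow_of_nonneg _ _ hP0, ← ENNReal.rpow_mul]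
    have h3 : (C : ℝ≥0∞) ^ P * (C : ℝ≥0∞) ^ (1 - P) = C := by
      rw [← ENNReal.rpow_add_of_nonneg _ _ hP0 (by linarith)]; simp
    nth_rewrite 3 [← h3]
    ring
  have ht1 : Q * P⁻¹ ≤ 1 := by
    rw [← div_eq_mul_inv]; exact div_le_one_of_le₀ hQP hP0
  have ht0 : 0 ≤ Q * P⁻¹ := by positivity
  refine (eLpNorm_le_interpolate
    (stronglyMeasurable_kernelConv K.continuous hF).aestronglyMeasurable hp hpq ha hb).trans
    (le_of_eq ?_)
  rw [← hP, ← hQ, ENNReal.mul_rpow_of_nonneg (C * N) _ (by linarith), ← mul_assoc,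
    ← ENNReal.rpow_add_of_nonneg _ _ ht0 (by linarith), ← ENNReal.rpow_mul, add_sub_cancel,
    ENNReal.rpow_one, mul_right_comm]
  congr 3
  -- If p = ∞, then q = ∞ as well, and the convention 0⁻¹ = 0 is harmless.
  rcases eq_or_ne P 0 with h0 | h0
  · have : Q = 0 := by linarith
    simp [h0, this]
  · field_simp

end Representation

/-! ### The extended Lᵖ norm on tempered distributions -/

section LpNorm

variable {p q : ℝ≥0∞} [Fact (1 ≤ p)] [Fact (1 ≤ q)]

theorem Lp_toTemperedDistribution_injective :
    Function.Injective (fun F : Lp ℂ p (volume : Measure (Eu d)) => (F : 𝓢'(Eu d, ℂ))) := by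
  have h := Lp.ker_toTemperedDistributionCLM_eq_bot (F := ℂ) (p := p)
    (μ := (volume : Measure (Eu d)))
  exact LinearMap.ker_eq_bot.1 h

theorem distLpNorm_coe (F : Lp ℂ p (volume : Measure (Eu d))) :
    distLpNorm p (F : 𝓢'(Eu d, ℂ)) = ‖F‖ₑ := by
  refine le_antisymm (iInf₂_le_of_le F rfl le_rfl) (le_iInf₂ fun G hG => ?_)
  rw [Lp_toTemperedDistribution_injective hG]

theorem exists_Lp_of_distLpNorm_ne_top {u : 𝓢'(Eu d, ℂ)} (h : distLpNorm p u ≠ ∞) :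
    ∃ F : Lp ℂ p (volume : Measure (Eu d)), (F : 𝓢'(Eu d, ℂ)) = u ∧ ‖F‖ₑ = distLpNorm p u := by
  by_cases hF : ∃ F : Lp ℂ p (volume : Measure (Eu d)), (F : 𝓢'(Eu d, ℂ)) = u
  · obtain ⟨F, rfl⟩ := hF
    exact ⟨F, rfl, (distLpNorm_coe F).symm⟩
  · refine absurd ?_ h
    push Not at hF
    simp [distLpNorm, hF]

theorem distLpNorm_zero : distLpNorm p (0 : 𝓢'(Eu d, ℂ)) = 0 := by
  have h := distLpNorm_coe (0 : Lp ℂ p (volume : Measure (Eu d)))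
  rw [enorm_zero] at h
  rw [← h]
  exact congrArg _ (map_zero (Lp.toTemperedDistributionCLM ℂ (volume : Measure (Eu d)) p)).symm

theorem distLpNorm_add_le (u v : 𝓢'(Eu d, ℂ)) :
    distLpNorm p (u + v) ≤ distLpNorm p u + distLpNorm p v := by
  by_cases hu : distLpNorm p u = ∞
  · simp [hu]
  by_cases hv : distLpNorm p v = ∞
  · simp [hv]
  obtain ⟨F, rfl, hF⟩ := exists_Lp_of_distLpNorm_ne_top hu
  obtain ⟨G, rfl, hG⟩ := exists_Lp_of_distLpNorm_ne_top hv
  have : (F : 𝓢'(Eu d, ℂ)) + (G : 𝓢'(Eu d, ℂ)) = ((F + G : Lp ℂ p volume) : 𝓢'(Eu d, ℂ)) :=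
    (map_add (Lp.toTemperedDistributionCLM ℂ (volume : Measure (Eu d)) p) F G).symm
  rw [this, distLpNorm_coe, ← hF, ← hG]
  exact enorm_add_le _ _

theorem distLpNorm_smul_le (c : ℂ) (u : 𝓢'(Eu d, ℂ)) :
    distLpNorm p (c • u) ≤ ‖c‖ₑ * distLpNorm p u := by
  rcases eq_or_ne c 0 with rfl | hc
  · have : (0 : ℂ) • u = 0 := by ext; simp
    rw [this, distLpNorm_zero]; exact zero_le
  by_cases hu : distLpNorm p u = ∞
  · rw [hu, ENNReal.mul_top (by simpa using hc)]; exact le_top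
  obtain ⟨F, rfl, hF⟩ := exists_Lp_of_distLpNorm_ne_top hu
  have : c • (F : 𝓢'(Eu d, ℂ)) = ((c • F : Lp ℂ p volume) : 𝓢'(Eu d, ℂ)) :=
    (map_smul (Lp.toTemperedDistributionCLM ℂ (volume : Measure (Eu d)) p) c F).symm
  rw [this, distLpNorm_coe, ← hF, enorm_smul]

/-- Absolutely convergent series in `Lᵖ` converge as tempered distributions. -/
theorem exists_tendsto_of_tsum_distLpNorm_ne_top (u : ℕ → 𝓢'(Eu d, ℂ))
    (h : ∑' n, distLpNorm p (u n) ≠ ∞) :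
    ∃ U : 𝓢'(Eu d, ℂ), Tendsto (fun N => ∑ n ∈ Finset.range N, u n) atTop (𝓝 U) ∧
      distLpNorm p U ≤ ∑' n, distLpNorm p (u n) := by
  choose F hF hF' using fun n => exists_Lp_of_distLpNorm_ne_top (ENNReal.ne_top_of_tsum_ne_top h n)
  simp_rw [← hF'] at h ⊢
  have hs : Summable F := by
    refine Summable.of_nnnorm ?_
    rw [← ENNReal.tsum_coe_ne_top_iff_summable]
    exact h
  refine ⟨((∑' n, F n : Lp ℂ p volume) : 𝓢'(Eu d, ℂ)), ?_, ?_⟩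
  · have := (hs.hasSum.mapL (Lp.toTemperedDistributionCLM ℂ (volume : Measure (Eu d)) p))
    simp_rw [← hF]
    exact this.tendsto_sum_nat
  · rw [distLpNorm_coe]
    exact enorm_tsum_le_tsum_enorm

theorem tendsto_zero_of_distLpNorm {ι : Type*} {l : Filter ι} {u : ι → 𝓢'(Eu d, ℂ)}
    (h : Tendsto (fun i => distLpNorm p (u i)) l (𝓝 0)) : Tendsto u l (𝓝 0) := by
  classical
  -- The default 0 is used only where the norm is infinite, which eventually does not happen.
  let F : ι → Lp ℂ p (volume : Measure (Eu d)) := fun i =>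
    if hi : distLpNorm p (u i) ≠ ∞ then (exists_Lp_of_distLpNorm_ne_top hi).choose else 0
  have hev : ∀ᶠ i in l, distLpNorm p (u i) ≠ ∞ :=
    (h.eventually (gt_mem_nhds ENNReal.zero_lt_top)).mono fun i hi => hi.ne
  have hF : ∀ᶠ i in l, (F i : 𝓢'(Eu d, ℂ)) = u i ∧ ‖F i‖ₑ = distLpNorm p (u i) := by
    refine hev.mono fun i hi => ?_
    simp only [F, dif_pos hi]
    exact (exists_Lp_of_distLpNorm_ne_top hi).choose_spec
  have h0 : Tendsto F l (𝓝 0) := by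
    rw [tendsto_zero_iff_enorm_tendsto_zero]
    exact h.congr' (hF.mono fun i hi => hi.2.symm)
  have h1 := ((Lp.toTemperedDistributionCLM ℂ (volume : Measure (Eu d)) p).continuous.tendsto 0).comp
    h0
  rw [map_zero] at h1
  exact h1.congr' (hF.mono fun i hi => hi.1)

theorem toLp_toTemperedDistribution_eq {F : Eu d → ℂ} (hF : F.HasTemperateGrowth)
    (hp : MemLp F p volume) :
    ((hp.toLp F : Lp ℂ p volume) : 𝓢'(Eu d, ℂ)) = hF.toTemperedDistribution := by
  ext ψ
  rw [Lp.toTemperedDistribution_apply,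
    Function.HasTemperateGrowth.toTemperedDistribution_apply volume]
  refine integral_congr_ae (hp.coeFn_toLp.mono fun x hx => ?_)
  simp only [hx]

theorem ae_eq_of_toTemperedDistribution_eq {F : Eu d → ℂ} (hF : F.HasTemperateGrowth)
    (G : Lp ℂ p (volume : Measure (Eu d)))
    (h : (G : 𝓢'(Eu d, ℂ)) = hF.toTemperedDistribution) : G =ᵐ[volume] F := by
  have hGl : LocallyIntegrable G volume := (Lp.memLp G).locallyIntegrable Fact.out
  have hFl : LocallyIntegrable F volume := hF.1.continuous.locallyIntegrable
  have : ∀ᵐ x, G x - F x = 0 := by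
    refine ae_eq_zero_of_integral_contDiff_smul_eq_zero (hGl.sub hFl) fun g g_smooth g_cpt => ?_
    have hg₁ : HasCompactSupport (Complex.ofRealCLM ∘ g) := g_cpt.comp_left rfl
    have hg₂ : ContDiff ℝ (⊤ : ℕ∞) (Complex.ofRealCLM ∘ g) := by fun_prop
    have h1 := DFunLike.congr_fun h (hg₁.toSchwartzMap hg₂)
    rw [Lp.toTemperedDistribution_apply,
      Function.HasTemperateGrowth.toTemperedDistribution_apply volume] at h1
    have h2 := hGl.integrable_smul_left_of_hasCompactSupport g_smooth.continuous g_cpt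
    have h3 := hFl.integrable_smul_left_of_hasCompactSupport g_smooth.continuous g_cpt
    simp only [smul_sub]
    rw [integral_sub h2 h3, sub_eq_zero]
    simpa using h1
  exact this.mono fun x hx => sub_eq_zero.1 hx

theorem distLpNorm_toTemperedDistribution {F : Eu d → ℂ} (hF : F.HasTemperateGrowth) :
    distLpNorm p (hF.toTemperedDistribution : 𝓢'(Eu d, ℂ)) = eLpNorm F p volume := by
  by_cases h : distLpNorm p (hF.toTemperedDistribution : 𝓢'(Eu d, ℂ)) = ∞
  · rw [h]
    by_contra hne
    have hp : MemLp F p volume :=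
      ⟨hF.1.continuous.aestronglyMeasurable, lt_top_iff_ne_top.2 (Ne.symm hne)⟩
    rw [← toLp_toTemperedDistribution_eq hF hp, distLpNorm_coe] at h
    exact enorm_ne_top h
  · obtain ⟨G, hG, hG'⟩ := exists_Lp_of_distLpNorm_ne_top h
    rw [← hG', Lp.enorm_def]
    exact eLpNorm_congr_ae (ae_eq_of_toTemperedDistribution_eq hF G hG)

theorem distLpNorm_mul_le {r : ℝ≥0∞} [Fact (1 ≤ r)] [p.HolderTriple q r] {F G : Eu d → ℂ}
    (hF : F.HasTemperateGrowth) (hG : G.HasTemperateGrowth) :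
    distLpNorm r ((hF.mul hG).toTemperedDistribution : 𝓢'(Eu d, ℂ)) ≤
      distLpNorm p (hF.toTemperedDistribution : 𝓢'(Eu d, ℂ)) *
        distLpNorm q (hG.toTemperedDistribution : 𝓢'(Eu d, ℂ)) := by
  have h1 := distLpNorm_toTemperedDistribution (p := p) hF
  have h2 := distLpNorm_toTemperedDistribution (p := q) hG
  have h3 := distLpNorm_toTemperedDistribution (p := r) (hF.mul hG)
  have h4 := eLpNorm_smul_le_mul_eLpNorm (p := p) (q := q) (r := r) (μ := volume)
    (φ := F) (f := G) hG.1.continuous.aestronglyMeasurable hF.1.continuous.aestronglyMeasurable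
  rw [← h1, ← h2] at h4
  exact h3.trans_le h4

end LpNorm

/-! ### Powers of two in `ℝ≥0∞` -/

theorem two_rpow_ne_top (x : ℝ) : (2 : ℝ≥0∞) ^ x ≠ ∞ := by
  simp [ENNReal.rpow_eq_top_iff]

theorem two_rpow_ne_zero (x : ℝ) : (2 : ℝ≥0∞) ^ x ≠ 0 := by
  simp [ENNReal.rpow_eq_zero_iff]

theorem two_rpow_add (x y : ℝ) : (2 : ℝ≥0∞) ^ (x + y) = 2 ^ x * 2 ^ y :=
  ENNReal.rpow_add x y two_ne_zero ENNReal.ofNat_ne_top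

theorem two_rpow_le {x y : ℝ} (h : x ≤ y) : (2 : ℝ≥0∞) ^ x ≤ 2 ^ y :=
  ENNReal.rpow_le_rpow_of_exponent_le one_le_two h

/-! ### Bernstein's inequality and spectra of products -/

section Bernstein

variable {m : Eu d → ℂ}

/-- Bernstein's inequality. -/
theorem IsSymbol.exists_bernstein (hm : IsSymbol m) : ∃ C : ℝ≥0, 1 ≤ C ∧
    ∀ (p q : ℝ≥0∞) [Fact (1 ≤ p)] [Fact (1 ≤ q)], p ≤ q → ∀ (j : ℤ) (u : 𝓢'(Eu d, ℂ)),
      distLpNorm q (fourierMultiplierCLM ℂ (dilate m j) u) ≤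
        C * (2 : ℝ≥0∞) ^ ((j : ℝ) * (d * ((p⁻¹).toReal - (q⁻¹).toReal))) * distLpNorm p u := by
  obtain ⟨C, hC1, hC⟩ := hm.exists_eLpNorm_kernelConv_le
  refine ⟨C, hC1, fun p q hp hq hpq j u => ?_⟩
  by_cases hu : distLpNorm p u = ∞
  · rw [hu, ENNReal.mul_top]
    · exact le_top
    · exact mul_ne_zero (by simpa using (zero_lt_one.trans_le hC1).ne') (two_rpow_ne_zero _)
  obtain ⟨F, rfl, hF⟩ := exists_Lp_of_distLpNorm_ne_top hu
  have h := hC p q hp.out hpq j F (Lp.stronglyMeasurable F)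
  rw [← hF, Lp.enorm_def]
  set K := (hm.dilated j).kernel
  have hmem : MemLp (kernelConv K F) q volume := by
    refine ⟨(stronglyMeasurable_kernelConv K.continuous
      (Lp.stronglyMeasurable F)).aestronglyMeasurable, h.trans_lt ?_⟩
    refine ENNReal.mul_lt_top (ENNReal.mul_lt_top ENNReal.coe_lt_top ?_) (Lp.eLpNorm_lt_top F)
    exact (two_rpow_ne_top _).lt_top
  have : fourierMultiplierCLM ℂ (dilate m j) (F : 𝓢'(Eu d, ℂ)) =
      ((hmem.toLp _ : Lp ℂ q volume) : 𝓢'(Eu d, ℂ)) := by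
    ext ψ
    rw [(hm.dilated j).fourierMultiplier_apply_Lp, Lp.toTemperedDistribution_apply]
    refine integral_congr_ae (hmem.coeFn_toLp.mono fun x hx => ?_)
    simp only [hx]
    rfl
  rw [this, distLpNorm_coe, Lp.enorm_toLp]
  exact h

/-- The multiplier acts as convolution of a bounded function with a Schwartz kernel, so all
derivatives of the result are bounded. -/
theorem IsSymbol.exists_temperate (hm : IsSymbol m) {u : 𝓢'(Eu d, ℂ)} (hu : distLpNorm ∞ u ≠ ∞) :
    ∃ (F : Eu d → ℂ) (hF : F.HasTemperateGrowth),
      hF.toTemperedDistribution = fourierMultiplierCLM ℂ m u := by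
  obtain ⟨F, rfl, -⟩ := exists_Lp_of_distLpNorm_ne_top hu
  have hB : ∀ᵐ y, ‖F y‖ ≤ ‖F‖ := by
    have h := ae_le_eLpNormEssSup (f := F) (μ := (volume : Measure (Eu d)))
    rw [← eLpNorm_exponent_top, ← Lp.enorm_def] at h
    exact h.mono fun y hy => enorm_le_iff_norm_le.1 hy
  refine ⟨_, hasTemperateGrowth_kernelConv (Lp.stronglyMeasurable F) hB hm.kernel, ?_⟩
  ext ψ
  rw [hm.fourierMultiplier_apply_Lp]
  rfl

open FourierTransform in
/-- The spectrum of a product is contained in the sum of the spectra. -/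
theorem fourierMultiplier_mul_eq_zero {m a b : Eu d → ℂ} (hm : m.HasTemperateGrowth)
    (ha : a.HasTemperateGrowth) (hb : b.HasTemperateGrowth)
    (h : ∀ ξ η, a ξ ≠ 0 → b η ≠ 0 → m (ξ + η) = 0)
    {U V : Eu d → ℂ} (hU : U.HasTemperateGrowth) (hV : V.HasTemperateGrowth)
    {u v : 𝓢'(Eu d, ℂ)} (hUu : hU.toTemperedDistribution = fourierMultiplierCLM ℂ a u)
    (hVv : hV.toTemperedDistribution = fourierMultiplierCLM ℂ b v) :
    fourierMultiplierCLM ℂ m ((hU.mul hV).toTemperedDistribution : 𝓢'(Eu d, ℂ)) = 0 := by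
  ext ψ
  rw [fourierMultiplierCLM_apply_apply]
  set g : 𝓢(Eu d, ℂ) := SchwartzMap.smulLeftCLM ℂ m (𝓕⁻ ψ) with hg
  -- The factor V is moved onto the test function, leaving only the spectral localization of U to
  -- exploit.
  have h1 : ((hU.mul hV).toTemperedDistribution : 𝓢'(Eu d, ℂ)) (𝓕 g) =
      (hU.toTemperedDistribution : 𝓢'(Eu d, ℂ)) (SchwartzMap.smulLeftCLM ℂ V (𝓕 g)) := by
    refine ((hU.mul hV).toTemperedDistribution_apply volume _).trans
      (Eq.trans ?_ (hU.toTemperedDistribution_apply volume _).symm)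
    refine integral_congr_ae (Eventually.of_forall fun x => ?_)
    simp only [SchwartzMap.smulLeftCLM_apply_apply hV, smul_eq_mul, Pi.mul_apply]
    ring
  rw [h1, hUu, fourierMultiplierCLM_apply_apply]
  suffices SchwartzMap.smulLeftCLM ℂ a (𝓕⁻ (SchwartzMap.smulLeftCLM ℂ V (𝓕 g))) = 0 by
    rw [this]; simp
  ext ξ
  rw [SchwartzMap.smulLeftCLM_apply_apply ha]
  by_cases hξ : a ξ = 0
  · simp [hξ]
  -- At a fixed ξ this is V tested against the transform of g(· + ξ). The localization of V then
  -- leaves b(η) m(ξ + η), which vanishes when a(ξ) ≠ 0.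
  have h2 : 𝓕⁻ (SchwartzMap.smulLeftCLM ℂ V (𝓕 g)) ξ =
      (hV.toTemperedDistribution : 𝓢'(Eu d, ℂ)) (𝓕 (SchwartzMap.compSubConstCLM ℂ (-ξ) g)) := by
    refine Eq.trans ?_ (hV.toTemperedDistribution_apply volume _).symm
    rw [SchwartzMap.fourierInv_coe, Real.fourierInv_eq]
    refine integral_congr_ae (Eventually.of_forall fun x => ?_)
    have h3 : 𝓕 (SchwartzMap.compSubConstCLM ℂ (-ξ) g) x =
        Real.fourierChar (inner ℝ ξ x) • 𝓕 g x := by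
      have := congrFun (VectorFourier.fourierIntegral_comp_add_right Real.fourierChar
        (volume : Measure (Eu d)) (innerₗ (Eu d)) g ξ) x
      rw [SchwartzMap.fourier_coe, SchwartzMap.fourier_coe]
      refine Eq.trans ?_ this
      simp [VectorFourier.fourierIntegral, Real.fourier_eq]
    simp only [h3, SchwartzMap.smulLeftCLM_apply_apply hV, smul_eq_mul, real_inner_comm]
    rw [smul_mul_assoc, mul_comm]
  rw [h2, hVv, fourierMultiplierCLM_apply_apply]
  suffices SchwartzMap.smulLeftCLM ℂ b (𝓕⁻ (𝓕 (SchwartzMap.compSubConstCLM ℂ (-ξ) g))) = 0 by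
    rw [this]; simp
  ext η
  rw [SchwartzMap.smulLeftCLM_apply_apply hb, FourierTransform.fourierInv_fourier_eq,
    SchwartzMap.compSubConstCLM_apply, hg, SchwartzMap.smulLeftCLM_apply_apply hm]
  by_cases hη : b η = 0
  · simp [hη]
  · rw [sub_neg_eq_add, add_comm η ξ, h ξ η hξ hη]
    simp

end Bernstein

/-! ### Functions of temperate growth as distributions -/

section OfFun

open Classical in
/-- The tempered distribution given by a function of temperate growth, and `0` for other
functions. -/
def ofFun (F : Eu d → ℂ) : 𝓢'(Eu d, ℂ) :=
  if h : F.HasTemperateGrowth then h.toTemperedDistribution else 0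

variable {F G : Eu d → ℂ}

theorem ofFun_eq (hF : F.HasTemperateGrowth) : ofFun F = hF.toTemperedDistribution := by
  rw [ofFun, dif_pos hF]

theorem ofFun_apply (hF : F.HasTemperateGrowth) (ψ : 𝓢(Eu d, ℂ)) :
    ofFun F ψ = ∫ x, ψ x • F x := by
  rw [ofFun_eq hF]; rfl

theorem integrable_schwartz_smul (hF : F.HasTemperateGrowth) (ψ : 𝓢(Eu d, ℂ)) :
    Integrable fun x => ψ x • F x := by
  have h := (SchwartzMap.smulLeftCLM ℂ F ψ).integrable (μ := volume)
  refine h.congr (Eventually.of_forall fun x => ?_)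
  rw [SchwartzMap.smulLeftCLM_apply_apply hF]
  simp [mul_comm]

theorem ofFun_add (hF : F.HasTemperateGrowth) (hG : G.HasTemperateGrowth) :
    ofFun (F + G) = ofFun F + ofFun G := by
  ext ψ
  have : (ofFun F + ofFun G) ψ = ofFun F ψ + ofFun G ψ := rfl
  rw [this, ofFun_apply hF, ofFun_apply hG, ofFun_apply (hF.add hG),
    ← integral_add (integrable_schwartz_smul hF ψ) (integrable_schwartz_smul hG ψ)]
  simp [mul_add]

theorem ofFun_sub (hF : F.HasTemperateGrowth) (hG : G.HasTemperateGrowth) :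
    ofFun (F - G) = ofFun F - ofFun G := by
  rw [eq_sub_iff_add_eq, ← ofFun_add (hF.sub hG) hG, sub_add_cancel]

theorem distLpNorm_ofFun_mul_le (p q r : ℝ≥0∞) [Fact (1 ≤ p)] [Fact (1 ≤ q)] [Fact (1 ≤ r)]
    [p.HolderTriple q r] (hF : F.HasTemperateGrowth) (hG : G.HasTemperateGrowth) :
    distLpNorm r (ofFun (F * G)) ≤ distLpNorm p (ofFun F) * distLpNorm q (ofFun G) := by
  rw [ofFun_eq hF, ofFun_eq hG, ofFun_eq (hF.mul hG)]
  exact distLpNorm_mul_le hF hG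

theorem fourierMultiplier_ofFun_mul_eq_zero {m a b : Eu d → ℂ} (hm : m.HasTemperateGrowth)
    (ha : a.HasTemperateGrowth) (hb : b.HasTemperateGrowth)
    (h : ∀ ξ η, a ξ ≠ 0 → b η ≠ 0 → m (ξ + η) = 0)
    (hF : F.HasTemperateGrowth) (hG : G.HasTemperateGrowth)
    {u v : 𝓢'(Eu d, ℂ)} (hFu : ofFun F = fourierMultiplierCLM ℂ a u)
    (hGv : ofFun G = fourierMultiplierCLM ℂ b v) :
    fourierMultiplierCLM ℂ m (ofFun (F * G)) = 0 := by
  rw [ofFun_eq (hF.mul hG)]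
  rw [ofFun_eq hF] at hFu
  rw [ofFun_eq hG] at hGv
  exact fourierMultiplier_mul_eq_zero hm ha hb h hF hG hFu hGv

end OfFun

/-! ### Algebra of Fourier multipliers -/

section Multipliers

theorem fourierMultiplierCLM_sub {a b : Eu d → ℂ} (ha : a.HasTemperateGrowth)
    (hb : b.HasTemperateGrowth) (u : 𝓢'(Eu d, ℂ)) :
    fourierMultiplierCLM ℂ (a - b) u =
      fourierMultiplierCLM ℂ a u - fourierMultiplierCLM ℂ b u := by
  rw [fourierMultiplierCLM_apply, smulLeftCLM_sub ha hb]
  exact map_sub (FourierTransform.fourierInvCLM ℂ 𝓢'(Eu d, ℂ)) _ _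

theorem fourierMultiplierCLM_one (u : 𝓢'(Eu d, ℂ)) : fourierMultiplierCLM ℂ 1 u = u :=
  DFunLike.congr_fun (fourierMultiplierCLM_const (F := ℂ) (E := Eu d) 1) u |>.trans (one_smul ℂ u)

theorem fourierMultiplierCLM_comp {a b c : Eu d → ℂ} (ha : a.HasTemperateGrowth)
    (hb : b.HasTemperateGrowth) (hc : ∀ ξ, a ξ * b ξ = c ξ) (u : 𝓢'(Eu d, ℂ)) :
    fourierMultiplierCLM ℂ b (fourierMultiplierCLM ℂ a u) = fourierMultiplierCLM ℂ c u := by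
  rw [fourierMultiplierCLM_fourierMultiplierCLM_apply ha hb]
  congr 2
  exact funext hc

/-- If `b = 1` wherever `1 - b` could see the spectrum of `u`, then `b` acts trivially. -/
theorem fourierMultiplierCLM_eq_self {b : Eu d → ℂ} (hb : b.HasTemperateGrowth)
    {u : 𝓢'(Eu d, ℂ)} (h : fourierMultiplierCLM ℂ (1 - b) u = 0) :
    fourierMultiplierCLM ℂ b u = u := by
  have h1 : (1 : Eu d → ℂ).HasTemperateGrowth := .const 1
  rw [fourierMultiplierCLM_sub h1 hb, fourierMultiplierCLM_one, sub_eq_zero] at h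
  exact h.symm

end Multipliers

/-! ### Supports of the Littlewood-Paley symbols -/

section Cutoff

variable {χ : Eu d → ℝ}

/-- The symbol `χ(c ·)`. -/
def scaledCutoff (χ : Eu d → ℝ) (c : ℝ) (ξ : Eu d) : ℂ := ((χ (c • ξ) : ℝ) : ℂ)

theorem IsCutoff.isSymbol (hχ : IsCutoff χ) {c : ℝ} (hc : 0 < c) : IsSymbol (scaledCutoff χ c) where
  smooth := by
    have h : ContDiff ℝ (⊤ : ℕ∞) fun ξ => χ (c • ξ) := hχ.smooth.comp (contDiff_const_smul c)
    exact Complex.ofRealCLM.contDiff.comp h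
  hasCompactSupport := by
    have h : HasCompactSupport χ :=
      (isCompact_closedBall 0 (4 / 3)).of_isClosed_subset (isClosed_tsupport _) hχ.support_subset
    exact (h.comp_smul hc.ne').comp_left (g := fun x : ℝ => (x : ℂ)) (by simp)

theorem IsCutoff.scaledCutoff_eq_zero (hχ : IsCutoff χ) {c : ℝ} (hc : 0 ≤ c) {ξ : Eu d}
    (h : 4 / 3 < c * ‖ξ‖) : scaledCutoff χ c ξ = 0 := by
  have : c • ξ ∉ tsupport χ := fun hmem => by
    have := hχ.support_subset hmem
    rw [mem_closedBall_zero_iff, norm_smul, Real.norm_of_nonneg hc] at this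
    linarith
  simp [scaledCutoff, image_eq_zero_of_notMem_tsupport this]

theorem IsCutoff.scaledCutoff_eq_one (hχ : IsCutoff χ) {c : ℝ} (hc : 0 ≤ c) {ξ : Eu d}
    (h : c * ‖ξ‖ < 3 / 4) : scaledCutoff χ c ξ = 1 := by
  have : c • ξ ∈ Metric.ball (0 : Eu d) (3 / 4) := by
    rwa [mem_ball_zero_iff, norm_smul, Real.norm_of_nonneg hc]
  simp [scaledCutoff, hχ.eq_one _ this]

/-- The symbol `φ = χ(·/2) - χ`. -/
def annulusSymbol (χ : Eu d → ℝ) : Eu d → ℂ := scaledCutoff χ 2⁻¹ - scaledCutoff χ 1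

/-- A symbol equal to `1` on a neighbourhood of the spectrum of the paraproduct blocks. -/
def wideAnnulusSymbol (χ : Eu d → ℝ) : Eu d → ℂ := scaledCutoff χ 8⁻¹ - scaledCutoff χ 4

theorem IsSymbol.sub {a b : Eu d → ℂ} (ha : IsSymbol a) (hb : IsSymbol b) : IsSymbol (a - b) where
  smooth := ha.smooth.sub hb.smooth
  hasCompactSupport := ha.hasCompactSupport.sub hb.hasCompactSupport

theorem IsCutoff.isSymbol_annulus (hχ : IsCutoff χ) : IsSymbol (annulusSymbol χ) :=
  (hχ.isSymbol (by norm_num)).sub (hχ.isSymbol one_pos)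

theorem IsCutoff.isSymbol_wideAnnulus (hχ : IsCutoff χ) : IsSymbol (wideAnnulusSymbol χ) :=
  (hχ.isSymbol (by norm_num)).sub (hχ.isSymbol (by norm_num))

theorem IsCutoff.norm_le_of_scaledCutoff_ne_zero (hχ : IsCutoff χ) {c : ℝ} (hc : 0 ≤ c) {ξ : Eu d}
    (h : scaledCutoff χ c ξ ≠ 0) : c * ‖ξ‖ ≤ 4 / 3 := by
  by_contra hlt
  exact h (hχ.scaledCutoff_eq_zero hc (not_le.1 hlt))

theorem IsCutoff.norm_of_annulus_ne_zero (hχ : IsCutoff χ) {ξ : Eu d}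
    (h : annulusSymbol χ ξ ≠ 0) : 3 / 4 ≤ ‖ξ‖ ∧ ‖ξ‖ ≤ 8 / 3 := by
  constructor
  · by_contra hlt
    rw [not_le] at hlt
    refine h ?_
    rw [annulusSymbol, Pi.sub_apply, hχ.scaledCutoff_eq_one (by norm_num) (by linarith [norm_nonneg ξ]),
      hχ.scaledCutoff_eq_one (by norm_num) (by linarith), sub_self]
  · by_contra hlt
    rw [not_le] at hlt
    refine h ?_
    rw [annulusSymbol, Pi.sub_apply, hχ.scaledCutoff_eq_zero (by norm_num) (by linarith),
      hχ.scaledCutoff_eq_zero (by norm_num) (by linarith), sub_self]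

theorem IsCutoff.norm_of_wideAnnulus_ne_zero (hχ : IsCutoff χ) {ξ : Eu d}
    (h : wideAnnulusSymbol χ ξ ≠ 0) : 3 / 16 ≤ ‖ξ‖ := by
  by_contra hlt
  rw [not_le] at hlt
  refine h ?_
  rw [wideAnnulusSymbol, Pi.sub_apply,
    hχ.scaledCutoff_eq_one (by norm_num) (by linarith [norm_nonneg ξ]),
    hχ.scaledCutoff_eq_one (by norm_num) (by linarith), sub_self]

/-- The range [5/12, 3] is where the paraproduct blocks live after rescaling; χ(ξ/8) = 1 for |ξ| < 6
and χ(4ξ) = 0 for |ξ| > 1/3. -/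
theorem IsCutoff.wideAnnulus_eq_one (hχ : IsCutoff χ) {ξ : Eu d} (h1 : 5 / 12 ≤ ‖ξ‖)
    (h2 : ‖ξ‖ ≤ 3) : wideAnnulusSymbol χ ξ = 1 := by
  rw [wideAnnulusSymbol, Pi.sub_apply, hχ.scaledCutoff_eq_one (by norm_num) (by linarith),
    hχ.scaledCutoff_eq_zero (by norm_num) (by linarith), sub_zero]

theorem lowFreq_eq (j : ℤ) (u : 𝓢'(Eu d, ℂ)) :
    lowFreq χ j u = fourierMultiplierCLM ℂ (dilate (scaledCutoff χ 1) j) u := by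
  have : (fun ξ : Eu d => ((χ ((2 : ℝ) ^ (-j) • ξ) : ℝ) : ℂ)) = dilate (scaledCutoff χ 1) j := by
    ext ξ
    simp [dilate, scaledCutoff]
  rw [lowFreq, this]

theorem dyadicBlock_eq (j : ℤ) (u : 𝓢'(Eu d, ℂ)) :
    dyadicBlock χ j u = fourierMultiplierCLM ℂ (dilate (annulusSymbol χ) j) u := by
  have : (fun ξ : Eu d => ((annulus χ ((2 : ℝ) ^ (-j) • ξ) : ℝ) : ℂ)) =
      dilate (annulusSymbol χ) j := by
    ext ξ
    simp [dilate, annulusSymbol, annulus, scaledCutoff]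
  rw [dyadicBlock, this]

theorem dilate_add_one_cutoff (j : ℤ) :
    dilate (scaledCutoff χ 1) (j + 1) = dilate (scaledCutoff χ 2⁻¹) j := by
  ext ξ
  simp only [dilate, scaledCutoff, smul_smul]
  rw [neg_add, zpow_add₀ two_ne_zero, zpow_neg_one, one_mul, mul_comm]

theorem IsCutoff.dyadicBlock_eq_sub (hχ : IsCutoff χ) (j : ℤ) (u : 𝓢'(Eu d, ℂ)) :
    dyadicBlock χ j u = lowFreq χ (j + 1) u - lowFreq χ j u := by
  rw [dyadicBlock_eq, lowFreq_eq, lowFreq_eq, dilate_add_one_cutoff,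
    ← fourierMultiplierCLM_sub ((hχ.isSymbol (by norm_num)).dilated j).hasTemperateGrowth
      ((hχ.isSymbol one_pos).dilated j).hasTemperateGrowth]
  rfl

/-- The wider cutoff is 1 on the support of χ, since (1/2)(4/3) < 3/4. This reproducing identity
turns a bounded Ṡ_j u into a convolution of itself. -/
theorem IsCutoff.lowFreq_lowFreq (hχ : IsCutoff χ) (j : ℤ) (u : 𝓢'(Eu d, ℂ)) :
    fourierMultiplierCLM ℂ (dilate (scaledCutoff χ 2⁻¹) j) (lowFreq χ j u) = lowFreq χ j u := by
  rw [lowFreq_eq]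
  refine fourierMultiplierCLM_comp ((hχ.isSymbol one_pos).dilated j).hasTemperateGrowth
    ((hχ.isSymbol (by norm_num)).dilated j).hasTemperateGrowth (fun ξ => ?_) u
  simp only [dilate]
  set ζ := (2 : ℝ) ^ (-j) • ξ
  by_cases h : scaledCutoff χ 1 ζ = 0
  · rw [h, zero_mul]
  · have := hχ.norm_le_of_scaledCutoff_ne_zero zero_le_one h
    rw [hχ.scaledCutoff_eq_one (c := 2⁻¹) (by norm_num) (by linarith), mul_one]

/-- Here (1/4)(8/3) < 3/4. Reproducing the block lets Bernstein have the block itself on its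
right-hand side. -/
theorem IsCutoff.lowFreq_dyadicBlock (hχ : IsCutoff χ) (j : ℤ) (u : 𝓢'(Eu d, ℂ)) :
    fourierMultiplierCLM ℂ (dilate (scaledCutoff χ 4⁻¹) j) (dyadicBlock χ j u) =
      dyadicBlock χ j u := by
  rw [dyadicBlock_eq]
  refine fourierMultiplierCLM_comp (hχ.isSymbol_annulus.dilated j).hasTemperateGrowth
    ((hχ.isSymbol (by norm_num)).dilated j).hasTemperateGrowth (fun ξ => ?_) u
  simp only [dilate]
  set ζ := (2 : ℝ) ^ (-j) • ξ
  by_cases h : annulusSymbol χ ζ = 0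
  · rw [h, zero_mul]
  · have := hχ.norm_of_annulus_ne_zero h
    rw [hχ.scaledCutoff_eq_one (by norm_num) (by linarith), mul_one]

end Cutoff

/-! ### Besov norms for r = 1 and r = ∞ -/

section BesovNorm

variable {χ : Eu d → ℝ} {s : ℝ} {p : ℝ≥0∞} [Fact (1 ≤ p)] {u : 𝓢'(Eu d, ℂ)}

theorem besovNorm_one :
    besovNorm χ s p 1 u = ∑' j : ℤ, (2 : ℝ≥0∞) ^ ((j : ℝ) * s) * distLpNorm p (dyadicBlock χ j u) := by
  rw [besovNorm, eLpNorm_one_eq_lintegral_enorm, lintegral_count]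
  simp

theorem le_besovNorm_top (j : ℤ) :
    (2 : ℝ≥0∞) ^ ((j : ℝ) * s) * distLpNorm p (dyadicBlock χ j u) ≤ besovNorm χ s p ∞ u := by
  rw [besovNorm, eLpNorm_exponent_top]
  have h := ae_le_eLpNormEssSup (μ := (Measure.count : Measure ℤ))
    (f := fun j : ℤ => (2 : ℝ≥0∞) ^ ((j : ℝ) * s) * distLpNorm p (dyadicBlock χ j u))
  exact (Measure.ae_count_iff.1 h) j

theorem besovNorm_top_le {c : ℝ≥0∞}
    (h : ∀ j : ℤ, (2 : ℝ≥0∞) ^ ((j : ℝ) * s) * distLpNorm p (dyadicBlock χ j u) ≤ c) :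
    besovNorm χ s p ∞ u ≤ c := by
  rw [besovNorm, eLpNorm_exponent_top]
  exact eLpNormEssSup_le_of_ae_enorm_bound (Eventually.of_forall h)

theorem eq_two_rpow_mul (x : ℝ) (a : ℝ≥0∞) : a = (2 : ℝ≥0∞) ^ (-x) * (2 ^ x * a) := by
  rw [← mul_assoc, ← two_rpow_add]; simp

theorem distLpNorm_dyadicBlock_le_top (j : ℤ) :
    distLpNorm p (dyadicBlock χ j u) ≤ (2 : ℝ≥0∞) ^ (-((j : ℝ) * s)) * besovNorm χ s p ∞ u := by
  rw [eq_two_rpow_mul ((j : ℝ) * s) (distLpNorm p _)]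
  gcongr
  exact le_besovNorm_top j

theorem distLpNorm_dyadicBlock_le_one (j : ℤ) :
    distLpNorm p (dyadicBlock χ j u) ≤ (2 : ℝ≥0∞) ^ (-((j : ℝ) * s)) * besovNorm χ s p 1 u := by
  rw [eq_two_rpow_mul ((j : ℝ) * s) (distLpNorm p _)]
  gcongr
  rw [besovNorm_one]
  exact ENNReal.le_tsum (f := fun j : ℤ =>
    (2 : ℝ≥0∞) ^ ((j : ℝ) * s) * distLpNorm p (dyadicBlock χ j u)) j

end BesovNorm

theorem two_rpow_mul_le_mul {x y z w : ℝ} {c a : ℝ≥0∞} (h : x + y ≤ z + w) :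
    c * 2 ^ x * (2 ^ y * a) ≤ c * 2 ^ z * (2 ^ w * a) := by
  have h1 : ∀ x y : ℝ, c * 2 ^ x * (2 ^ y * a) = c * 2 ^ (x + y) * a := fun x y => by
    rw [two_rpow_add]; ring
  rw [h1, h1]
  exact mul_le_mul' (mul_le_mul' le_rfl (two_rpow_le h)) le_rfl

theorem two_rpow_mul_le {x z w : ℝ} {c a : ℝ≥0∞} (h : x ≤ z + w) :
    c * 2 ^ x * a ≤ c * 2 ^ z * (2 ^ w * a) := by
  simpa using two_rpow_mul_le_mul (x := x) (y := 0) (c := c) (a := a) (by simpa using h)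

/-! ### Bounds on low frequency parts -/

section LowFreq

variable {χ : Eu d → ℝ}

theorem IsCutoff.exists_bernstein_dyadicBlock (hχ : IsCutoff χ) : ∃ C : ℝ≥0, 1 ≤ C ∧
    ∀ (p q : ℝ≥0∞) [Fact (1 ≤ p)] [Fact (1 ≤ q)], p ≤ q → ∀ (j : ℤ) (u : 𝓢'(Eu d, ℂ)),
      distLpNorm q (dyadicBlock χ j u) ≤ C * (2 : ℝ≥0∞) ^
        ((j : ℝ) * (d * ((p⁻¹).toReal - (q⁻¹).toReal))) * distLpNorm p (dyadicBlock χ j u) := by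
  obtain ⟨C, hC1, hC⟩ := (hχ.isSymbol (c := 4⁻¹) (by norm_num)).exists_bernstein
  refine ⟨C, hC1, fun p q _ _ hpq j u => ?_⟩
  have := hC p q hpq j (dyadicBlock χ j u)
  rwa [hχ.lowFreq_dyadicBlock] at this

/-- The low frequency part of an element of `𝓢'_0` is the sum of its dyadic blocks. -/
theorem IsCutoff.distLpNorm_lowFreq_le_tsum (hχ : IsCutoff χ) {u : 𝓢'(Eu d, ℂ)}
    (hu : VanishesAtLowFreq χ u) (q : ℝ≥0∞) [Fact (1 ≤ q)] (k : ℤ) :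
    distLpNorm q (lowFreq χ k u) ≤ ∑' n : ℕ, distLpNorm q (dyadicBlock χ (k - 1 - n) u) := by
  by_cases htop : ∑' n : ℕ, distLpNorm q (dyadicBlock χ (k - 1 - n) u) = ∞
  · rw [htop]; exact le_top
  obtain ⟨U, hU, hUle⟩ := exists_tendsto_of_tsum_distLpNorm_ne_top _ htop
  have hsum : ∀ N : ℕ, ∑ n ∈ Finset.range N, dyadicBlock χ (k - 1 - n) u =
      lowFreq χ k u - lowFreq χ (k - N) u := by
    intro N
    induction N with
    | zero => simp
    | succ N ih =>
      rw [Finset.sum_range_succ, ih, hχ.dyadicBlock_eq_sub,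
        show k - 1 - (N : ℤ) + 1 = k - N by ring,
        show k - 1 - (N : ℤ) = k - (N + 1 : ℕ) by push_cast; ring]
      abel
  simp_rw [hsum] at hU
  have h0 : Tendsto (fun N : ℕ => lowFreq χ (k - N) u) atTop (𝓝 0) := by
    refine (tendsto_zero_of_distLpNorm (p := ∞) hu).comp ?_
    exact tendsto_atBot.2 fun b => by
      filter_upwards [eventually_ge_atTop (k - b).toNat] with N hN
      omega
  have h1 : Tendsto (fun N : ℕ => lowFreq χ k u - lowFreq χ (k - N) u) atTop
      (𝓝 (lowFreq χ k u - 0)) := tendsto_const_nhds.sub h0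
  rw [sub_zero] at h1
  rw [tendsto_nhds_unique h1 hU]
  exact hUle

/-- Every block below frequency 2^k has weight at most 2^{ke}, and the ℓ¹ norm does the summation,
so e = 0 is allowed. -/
theorem IsCutoff.exists_lowFreq_le_of_one (hχ : IsCutoff χ) {s : ℝ} {p q : ℝ≥0∞} [hp : Fact (1 ≤ p)]
    [Fact (1 ≤ q)] (hpq : p ≤ q) {e : ℝ} (he : e = d * ((p⁻¹).toReal - (q⁻¹).toReal) - s)
    (he0 : 0 ≤ e) : ∃ C : ℝ≥0, ∀ u ∈ besovSpace χ s p 1, ∀ k : ℤ,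
      distLpNorm q (lowFreq χ k u) ≤ C * (2 : ℝ≥0∞) ^ ((k : ℝ) * e) * besovNorm χ s p 1 u := by
  obtain ⟨C, hC1, hC⟩ := hχ.exists_bernstein_dyadicBlock
  refine ⟨C, fun u hu k => (hχ.distLpNorm_lowFreq_le_tsum hu.1 q k).trans ?_⟩
  calc ∑' n : ℕ, distLpNorm q (dyadicBlock χ (k - 1 - n) u)
      ≤ ∑' n : ℕ, C * (2 : ℝ≥0∞) ^ ((k : ℝ) * e) * ((2 : ℝ≥0∞) ^ (((k - 1 - n : ℤ) : ℝ) * s) *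
          distLpNorm p (dyadicBlock χ (k - 1 - n) u)) := by
        refine ENNReal.tsum_le_tsum fun n => (hC p q hpq _ u).trans ?_
        refine two_rpow_mul_le ?_
        push_cast
        have : 0 ≤ (1 + (n : ℝ)) * e := by positivity
        subst he
        nlinarith
    _ = C * (2 : ℝ≥0∞) ^ ((k : ℝ) * e) * ∑' n : ℕ, ((2 : ℝ≥0∞) ^ (((k - 1 - n : ℤ) : ℝ) * s) *
          distLpNorm p (dyadicBlock χ (k - 1 - n) u)) := ENNReal.tsum_mul_left
    _ ≤ _ := by
        gcongr
        rw [besovNorm_one]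
        exact ENNReal.tsum_comp_le_tsum_of_injective (f := fun n : ℕ => k - 1 - (n : ℤ))
          (fun a b h => by simpa using h) fun j : ℤ => (2 : ℝ≥0∞) ^ ((j : ℝ) * s) *
            distLpNorm p (dyadicBlock χ j u)

theorem exists_tsum_two_rpow_le {e : ℝ} (he : 0 < e) :
    ∃ C : ℝ≥0, ∑' n : ℕ, (2 : ℝ≥0∞) ^ (-((n : ℝ) * e)) ≤ C := by
  have h1 : (2 : ℝ≥0∞) ^ (-e) < 1 := ENNReal.rpow_lt_one_of_one_lt_of_neg (by norm_num) (by linarith)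
  have h2 : ∀ n : ℕ, (2 : ℝ≥0∞) ^ (-((n : ℝ) * e)) = ((2 : ℝ≥0∞) ^ (-e)) ^ n := fun n => by
    rw [← ENNReal.rpow_natCast, ← ENNReal.rpow_mul]
    congr 1
    ring
  simp_rw [h2, ENNReal.tsum_geometric]
  have h3 : (1 - (2 : ℝ≥0∞) ^ (-e))⁻¹ ≠ ∞ := 
    ENNReal.inv_ne_top.2 (tsub_pos_iff_lt.2 h1).ne'
  exact ⟨_, (ENNReal.coe_toNNReal h3).ge⟩

/-- With only a supremum available, the blocks are summed by the geometric series ∑ 2^{−ne}, which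
forces e > 0. -/
theorem IsCutoff.exists_lowFreq_le_of_top (hχ : IsCutoff χ) {s : ℝ} {p q : ℝ≥0∞} [hp : Fact (1 ≤ p)]
    [Fact (1 ≤ q)] (hpq : p ≤ q) {e : ℝ} (he : e = d * ((p⁻¹).toReal - (q⁻¹).toReal) - s)
    (he0 : 0 < e) : ∃ C : ℝ≥0, ∀ u ∈ besovSpace χ s p ∞, ∀ k : ℤ,
      distLpNorm q (lowFreq χ k u) ≤ C * (2 : ℝ≥0∞) ^ ((k : ℝ) * e) * besovNorm χ s p ∞ u := by
  obtain ⟨C, hC1, hC⟩ := hχ.exists_bernstein_dyadicBlock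
  obtain ⟨C', hC'⟩ := exists_tsum_two_rpow_le he0
  refine ⟨C * C', fun u hu k => (hχ.distLpNorm_lowFreq_le_tsum hu.1 q k).trans ?_⟩
  calc ∑' n : ℕ, distLpNorm q (dyadicBlock χ (k - 1 - n) u)
      ≤ ∑' n : ℕ, C * (2 : ℝ≥0∞) ^ ((k : ℝ) * e) * besovNorm χ s p ∞ u *
          (2 : ℝ≥0∞) ^ (-((n : ℝ) * e)) := by
        refine ENNReal.tsum_le_tsum fun n => (hC p q hpq _ u).trans ?_
        refine (mul_le_mul' le_rfl (distLpNorm_dyadicBlock_le_top (s := s) _)).trans ?_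
        rw [mul_assoc (_ * _) (besovNorm _ _ _ _ _), mul_comm (besovNorm _ _ _ _ _)]
        refine two_rpow_mul_le_mul ?_
        push_cast
        subst he
        nlinarith
    _ = C * (2 : ℝ≥0∞) ^ ((k : ℝ) * e) * besovNorm χ s p ∞ u *
          ∑' n : ℕ, (2 : ℝ≥0∞) ^ (-((n : ℝ) * e)) := ENNReal.tsum_mul_left
    _ ≤ C * (2 : ℝ≥0∞) ^ ((k : ℝ) * e) * besovNorm χ s p ∞ u * C' := by gcongr
    _ = _ := by push_cast; ring

/-- If the low frequency parts of `u` are bounded, they are functions of temperate growth. -/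
theorem IsCutoff.exists_ofFun_eq_lowFreq (hχ : IsCutoff χ) {u : 𝓢'(Eu d, ℂ)}
    (hu : ∀ k : ℤ, distLpNorm ∞ (lowFreq χ k u) ≠ ∞) :
    ∃ F : ℤ → Eu d → ℂ, ∀ k, (F k).HasTemperateGrowth ∧ ofFun (F k) = lowFreq χ k u := by
  choose F hF hFu using fun k =>
    ((hχ.isSymbol (c := 2⁻¹) (by norm_num)).dilated k).exists_temperate (hu k)
  refine ⟨F, fun k => ⟨hF k, ?_⟩⟩
  rw [ofFun_eq (hF k), hFu, hχ.lowFreq_lowFreq]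

end LowFreq

/-! ### Convergence and norms of telescoping series -/

section Telescope

/-- The symbol `κ / |·|^(2L)`. -/
def divNormPow (κ : Eu d → ℂ) (L : ℕ) (ξ : Eu d) : ℂ := κ ξ * ((((‖ξ‖ ^ 2) ^ L : ℝ) : ℂ))⁻¹

theorem IsSymbol.divNormPow {κ : Eu d → ℂ} (hκ : IsSymbol κ) {ρ : ℝ} (hρ : 0 < ρ)
    (h0 : ∀ ξ, ‖ξ‖ < ρ → κ ξ = 0) (L : ℕ) : IsSymbol (divNormPow κ L) where
  smooth := by
    rw [contDiff_iff_contDiffAt]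
    intro ξ
    by_cases hξ : ξ = 0
    · refine (contDiffAt_const (c := (0 : ℂ))).congr_of_eventuallyEq ?_
      filter_upwards [Metric.ball_mem_nhds ξ hρ] with η hη
      rw [hξ, mem_ball_zero_iff] at hη
      simp [HomBesov.divNormPow, h0 η hη]
    · refine hκ.smooth.contDiffAt.mul (ContDiffAt.inv ?_ ?_)
      · exact Complex.ofRealCLM.contDiff.contDiffAt.comp ξ
          ((contDiff_norm_sq ℝ).pow L).contDiffAt
      · have : 0 < ‖ξ‖ := norm_pos_iff.2 hξ
        exact_mod_cast (by positivity : ((‖ξ‖ ^ 2) ^ L : ℝ) ≠ 0)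
  hasCompactSupport := hκ.hasCompactSupport.mul_right

/-- A series of blocks localized in dyadic annuli whose `Lᵖ` norms grow at most geometrically
converges as tempered distributions. -/
theorem exists_tendsto_of_annular {κ : Eu d → ℂ} (hκ : IsSymbol κ) {ρ : ℝ} (hρ : 0 < ρ)
    (h0 : ∀ ξ, ‖ξ‖ < ρ → κ ξ = 0) (p : ℝ≥0∞) [Fact (1 ≤ p)] {W : ℤ → 𝓢'(Eu d, ℂ)}
    (hW : ∀ k, fourierMultiplierCLM ℂ (dilate κ k) (W k) = W k) {X : ℝ≥0∞} (hX : X ≠ ∞) {σ : ℝ}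
    (hWX : ∀ k : ℤ, distLpNorm p (W k) ≤ X * 2 ^ ((k : ℝ) * σ)) :
    ∃ U, Tendsto (fun N : ℕ => ∑ n ∈ Finset.range N, W n) atTop (𝓝 U) := by
  -- Chosen so that dividing by |ξ|^{2L} turns growth 2^{nσ} into decay 2^{−n}.
  set L : ℕ := ⌈|σ|⌉₊ + 1
  have hL : σ - 2 * L ≤ -1 := by
    have h1 : |σ| ≤ ⌈|σ|⌉₊ := Nat.le_ceil _
    have h2 := le_abs_self σ
    have h3 := abs_nonneg σ
    simp only [L]
    push_cast
    linarith
  have hθ := hκ.divNormPow hρ h0 L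
  obtain ⟨C, -, hC⟩ := hθ.exists_bernstein
  -- The total symbol is κ(2^{−n}ξ)/|ξ|^{2L}; multiplication by |ξ|^{2L} recovers W_n and is
  -- continuous on 𝓢'.
  let u : ℕ → 𝓢'(Eu d, ℂ) := fun n =>
    ((((2 : ℝ) ^ (2 * n * L))⁻¹ : ℝ) : ℂ) • fourierMultiplierCLM ℂ (dilate (divNormPow κ L) n) (W n)
  have hu : ∀ n, distLpNorm p (u n) ≤ C * X * 2 ^ (-((n : ℝ) * 1)) := by
    intro n
    refine (distLpNorm_smul_le _ _).trans ?_
    have h1 : ‖((((2 : ℝ) ^ (2 * n * L))⁻¹ : ℝ) : ℂ)‖ₑ = (2 : ℝ≥0∞) ^ (-(2 * n * L : ℝ)) := by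
      rw [← ofReal_norm, Complex.norm_real, Real.norm_of_nonneg (by positivity),
        ENNReal.ofReal_inv_of_pos (by positivity), ENNReal.ofReal_pow (by norm_num),
        ENNReal.rpow_neg, ← ENNReal.rpow_natCast]
      push_cast
      simp
    have h2 := (hC p p le_rfl n (W n)).trans (mul_le_mul' le_rfl (hWX n))
    rw [sub_self, mul_zero, mul_zero, ENNReal.rpow_zero, mul_one] at h2
    rw [h1]
    refine (mul_le_mul' le_rfl h2).trans ?_
    have h3 : (2 : ℝ≥0∞) ^ (-(2 * n * L : ℝ)) * (C * (X * 2 ^ (((n : ℤ) : ℝ) * σ))) =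
        C * X * 2 ^ (-(2 * n * L : ℝ) + ((n : ℤ) : ℝ) * σ) := by
      rw [two_rpow_add]; ring
    rw [h3]
    refine mul_le_mul' le_rfl (two_rpow_le ?_)
    push_cast
    have : (0 : ℝ) ≤ n := n.cast_nonneg
    nlinarith
  have hsum : ∑' n, distLpNorm p (u n) ≠ ∞ := by
    obtain ⟨C', hC'⟩ := exists_tsum_two_rpow_le one_pos
    refine ne_top_of_le_ne_top ?_ ((ENNReal.tsum_le_tsum hu).trans
      (ENNReal.tsum_mul_left.trans_le (mul_le_mul' le_rfl hC')))
    exact ENNReal.mul_ne_top (ENNReal.mul_ne_top ENNReal.coe_ne_top hX) ENNReal.coe_ne_top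
  obtain ⟨U, hU, -⟩ := exists_tendsto_of_tsum_distLpNorm_ne_top u hsum
  let g : Eu d → ℂ := fun ξ => (((‖ξ‖ ^ 2) ^ L : ℝ) : ℂ)
  have hg : g.HasTemperateGrowth := by
    have : (fun ξ : Eu d => (‖ξ‖ ^ 2) ^ L).HasTemperateGrowth := by fun_prop
    simp only [g]
    fun_prop
  have hgu : ∀ n, fourierMultiplierCLM ℂ g (u n) = W n := by
    intro n
    rw [map_smul, fourierMultiplierCLM_comp (hθ.dilated n).hasTemperateGrowth hg
      (c := ((((2 : ℝ) ^ (2 * n * L)) : ℝ) : ℂ) • dilate κ n),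
      fourierMultiplierCLM_smul (hκ.dilated n).hasTemperateGrowth, smul_apply, hW, smul_smul,
      ← Complex.ofReal_mul, inv_mul_cancel₀ (by positivity), Complex.ofReal_one, one_smul]
    intro ξ
    simp only [dilate, HomBesov.divNormPow, g, Pi.smul_apply, smul_eq_mul]
    set ζ := (2 : ℝ) ^ (-(n : ℤ)) • ξ with hζ
    have hξ : ξ = (2 : ℝ) ^ n • ζ := by
      rw [hζ, smul_smul, zpow_neg, zpow_natCast, mul_inv_cancel₀ (by positivity), one_smul]
    by_cases hz : ζ = 0
    · simp [hz, h0 0 (by simpa using hρ)]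
    · have h1 : (((‖ξ‖ ^ 2) ^ L : ℝ) : ℂ) =
          (((2 : ℝ) ^ (2 * n * L) : ℝ) : ℂ) * (((‖ζ‖ ^ 2) ^ L : ℝ) : ℂ) := by
        rw [← Complex.ofReal_mul, hξ, norm_smul, Real.norm_of_nonneg (by positivity)]
        congr 1
        ring
      have h2 : (((‖ζ‖ ^ 2) ^ L : ℝ) : ℂ) ≠ 0 := by
        have : 0 < ‖ζ‖ := norm_pos_iff.2 hz
        exact_mod_cast (by positivity : ((‖ζ‖ ^ 2) ^ L : ℝ) ≠ 0)
      rw [h1]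
      field_simp
  refine ⟨fourierMultiplierCLM ℂ g U, ?_⟩
  have := ((fourierMultiplierCLM ℂ g).continuous.tendsto U).comp hU
  simpa [Function.comp_def, map_sum, hgu] using this

variable {P W D : ℤ → 𝓢'(Eu d, ℂ)}

theorem telescope_sum (hP : ∀ k, P (k + 1) = P k + (W k + D k)) (j : ℤ) (N : ℕ) :
    ∑ n ∈ Finset.range N, (W (j + n) + D (j + n)) = P (j + N) - P j := by
  induction N with
  | zero => simp
  | succ N ih =>
    rw [Finset.sum_range_succ, ih, Nat.cast_succ, ← add_assoc j, hP]
    abel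

/-- The two parts converge for different reasons: W by annular localization, D by absolute
summability. -/
theorem exists_tendsto_of_telescope (hP : ∀ k, P (k + 1) = P k + (W k + D k))
    {κ : Eu d → ℂ} (hκ : IsSymbol κ) {ρ : ℝ} (hρ : 0 < ρ)
    (h0 : ∀ ξ, ‖ξ‖ < ρ → κ ξ = 0) (p q : ℝ≥0∞) [Fact (1 ≤ p)] [Fact (1 ≤ q)]
    (hW : ∀ k, fourierMultiplierCLM ℂ (dilate κ k) (W k) = W k) {X : ℝ≥0∞} (hX : X ≠ ∞) {σ : ℝ}
    (hWX : ∀ k : ℤ, distLpNorm p (W k) ≤ X * 2 ^ ((k : ℝ) * σ))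
    (hD : ∑' n : ℕ, distLpNorm q (D n) ≠ ∞) : ∃ h, Tendsto P atTop (𝓝 h) := by
  obtain ⟨U, hU⟩ := exists_tendsto_of_annular hκ hρ h0 p hW hX hWX
  obtain ⟨V, hV, -⟩ := exists_tendsto_of_tsum_distLpNorm_ne_top (fun n : ℕ => D n) hD
  have h1 := (tendsto_const_nhds (x := P 0)).add (hU.add hV)
  refine ⟨P 0 + (U + V), ?_⟩
  rw [← Nat.map_cast_int_atTop, tendsto_map'_iff]
  refine h1.congr fun N => ?_
  have := telescope_sum hP 0 N
  simp only [zero_add] at this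
  rw [← Finset.sum_add_distrib, this]
  simp

/-- The norm of a frequency localization of the limit of a telescoping sum. -/
theorem IsSymbol.exists_telescope_bound {m κ : Eu d → ℂ} (hm : IsSymbol m) (hκ : IsSymbol κ)
    (hm0 : ∀ ξ, 8 / 3 < ‖ξ‖ → m ξ = 0) (hκ0 : ∀ ξ, ‖ξ‖ < 3 / 16 → κ ξ = 0)
    (p q t : ℝ≥0∞) [Fact (1 ≤ p)] [Fact (1 ≤ q)] [Fact (1 ≤ t)] (hpt : p ≤ t) (hqt : q ≤ t)
    (σ e : ℝ) : ∃ C : ℝ≥0, ∀ (P W D : ℤ → 𝓢'(Eu d, ℂ)) (h : 𝓢'(Eu d, ℂ)) (X Y : ℝ≥0∞),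
      (∀ k, P (k + 1) = P k + (W k + D k)) →
      (∀ k, fourierMultiplierCLM ℂ (dilate κ k) (W k) = W k) →
      (∀ k : ℤ, distLpNorm p (W k) ≤ X * 2 ^ ((k : ℝ) * σ)) →
      (∀ j : ℤ, ∑' n : ℕ, distLpNorm q (D (j + n)) ≤ Y * 2 ^ (-((j : ℝ) * e))) →
      Tendsto P atTop (𝓝 h) → ∀ j : ℤ,
        distLpNorm t (fourierMultiplierCLM ℂ (dilate m j) h) ≤
          distLpNorm t (fourierMultiplierCLM ℂ (dilate m j) (P (j - 2))) +
          C * (X * 2 ^ ((j : ℝ) * (d * ((p⁻¹).toReal - (t⁻¹).toReal) + σ)) +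
            Y * 2 ^ ((j : ℝ) * (d * ((q⁻¹).toReal - (t⁻¹).toReal) - e))) := by
  obtain ⟨C, -, hC⟩ := hm.exists_bernstein
  -- `c1` absorbs the shifts between the six surviving blocks W_k and j; `c2` absorbs starting the
  -- D-sum at j − 2.
  set c1 : ℝ≥0 := ((2 : ℝ≥0∞) ^ (4 * |σ|)).toNNReal with hc1
  have hc1' : (c1 : ℝ≥0∞) = 2 ^ (4 * |σ|) := ENNReal.coe_toNNReal (two_rpow_ne_top _)
  set c2 : ℝ≥0 := ((2 : ℝ≥0∞) ^ (2 * e)).toNNReal with hc2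
  have hc2' : (c2 : ℝ≥0∞) = 2 ^ (2 * e) := ENNReal.coe_toNNReal (two_rpow_ne_top _)
  refine ⟨max (6 * C * c1) (C * c2), fun P W D h X Y hP hW hWX hD hlim j => ?_⟩
  set T := fourierMultiplierCLM (E := Eu d) ℂ (dilate m j)
  -- For k ≥ j + 4 the frequencies of W_k are at least (3/16)·16·2^j = 3·2^j, beyond the support
  -- radius (8/3)·2^j.
  have hTW0 : ∀ n : ℕ, n ∉ Finset.range 6 → distLpNorm t (T (W (j - 2 + n))) = 0 := by
    intro n hn
    rw [Finset.mem_range, not_lt] at hn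
    have : T (W (j - 2 + n)) = 0 := by
      rw [← hW (j - 2 + n), fourierMultiplierCLM_comp (c := 0)
        (hκ.dilated _).hasTemperateGrowth (hm.dilated j).hasTemperateGrowth]
      · have h1 := fourierMultiplierCLM_const (F := ℂ) (E := Eu d) 0
        rw [zero_smul] at h1
        exact DFunLike.congr_fun h1 _
      · intro ξ
        by_cases hξ : ‖(2 : ℝ) ^ (-(j - 2 + (n : ℤ))) • ξ‖ < 3 / 16
        · simp only [dilate, hκ0 _ hξ, zero_mul, Pi.zero_apply]
        · rw [not_lt, norm_smul, Real.norm_of_nonneg (by positivity)] at hξ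
          have h2 : 8 / 3 < ‖(2 : ℝ) ^ (-j) • ξ‖ := by
            rw [norm_smul, Real.norm_of_nonneg (by positivity)]
            have h3 : (2 : ℝ) ^ (-j) = 2 ^ ((n : ℤ) - 2) * 2 ^ (-(j - 2 + (n : ℤ))) := by
              rw [← zpow_add₀ two_ne_zero]; congr 1; ring
            have h4 : (16 : ℝ) ≤ 2 ^ ((n : ℤ) - 2) := by
              calc (16 : ℝ) = 2 ^ (4 : ℤ) := by norm_num
                _ ≤ _ := zpow_le_zpow_right₀ (by norm_num) (by omega)
            rw [h3, mul_assoc]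
            nlinarith
          simp only [dilate, hm0 _ h2, mul_zero, Pi.zero_apply]
    rw [this, distLpNorm_zero]
  have hTW : ∑' n : ℕ, distLpNorm t (T (W (j - 2 + n))) ≤
      (6 * C * c1 : ℝ≥0) * (X * 2 ^ ((j : ℝ) * (d * ((p⁻¹).toReal - (t⁻¹).toReal) + σ))) := by
    rw [tsum_eq_sum hTW0]
    have : ∀ n ∈ Finset.range 6, distLpNorm t (T (W (j - 2 + n))) ≤
        (C * c1 : ℝ≥0) * (X * 2 ^ ((j : ℝ) * (d * ((p⁻¹).toReal - (t⁻¹).toReal) + σ))) := by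
      intro n hn
      refine (hC p t hpt j _).trans ((mul_le_mul' le_rfl (hWX _)).trans ?_)
      rw [ENNReal.coe_mul, hc1', mul_comm X, mul_comm X, mul_assoc (C : ℝ≥0∞) (2 ^ (4 * |σ|)),
        ← mul_assoc ((2 : ℝ≥0∞) ^ (4 * |σ|)), ← two_rpow_add, mul_assoc,
        ← mul_assoc ((2 : ℝ≥0∞) ^ _) _ X, ← two_rpow_add]
      refine mul_le_mul' le_rfl (mul_le_mul' (two_rpow_le ?_) le_rfl)
      rw [Finset.mem_range] at hn
      have h5 : (n : ℝ) ≤ 5 := by exact_mod_cast Nat.lt_succ_iff.1 hn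
      have h6 : (0 : ℝ) ≤ n := n.cast_nonneg
      have h7 : ((n : ℝ) - 2) * σ ≤ 4 * |σ| := by
        rcases le_total 0 σ with hs | hs
        · rw [abs_of_nonneg hs]; nlinarith
        · rw [abs_of_nonpos hs]; nlinarith
      push_cast
      nlinarith
    refine (Finset.sum_le_sum this).trans (le_of_eq ?_)
    rw [Finset.sum_const, Finset.card_range, nsmul_eq_mul]
    push_cast
    ring
  have hTD : ∑' n : ℕ, distLpNorm t (T (D (j - 2 + n))) ≤
      (C * c2 : ℝ≥0) * (Y * 2 ^ ((j : ℝ) * (d * ((q⁻¹).toReal - (t⁻¹).toReal) - e))) := by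
    refine (ENNReal.tsum_le_tsum fun n => hC q t hqt j _).trans ?_
    rw [ENNReal.tsum_mul_left]
    refine (mul_le_mul' le_rfl (hD _)).trans (le_of_eq ?_)
    rw [ENNReal.coe_mul, hc2', mul_comm Y, mul_comm Y, mul_assoc (C : ℝ≥0∞) (2 ^ (2 * e)),
        ← mul_assoc ((2 : ℝ≥0∞) ^ (2 * e)), ← two_rpow_add, mul_assoc,
        ← mul_assoc ((2 : ℝ≥0∞) ^ _) _ Y, ← two_rpow_add]
    congr 3
    push_cast
    ring
  set bound := (max (6 * C * c1) (C * c2) : ℝ≥0) *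
    (X * 2 ^ ((j : ℝ) * (d * ((p⁻¹).toReal - (t⁻¹).toReal) + σ)) +
      Y * 2 ^ ((j : ℝ) * (d * ((q⁻¹).toReal - (t⁻¹).toReal) - e)))
  have htot : ∑' n : ℕ, distLpNorm t (T (W (j - 2 + n) + D (j - 2 + n))) ≤ bound := by
    calc _ ≤ ∑' n : ℕ, (distLpNorm t (T (W (j - 2 + n))) + distLpNorm t (T (D (j - 2 + n)))) :=
          ENNReal.tsum_le_tsum fun n => by rw [map_add]; exact distLpNorm_add_le _ _
      _ = _ := ENNReal.tsum_add
      _ ≤ _ := add_le_add hTW hTD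
      _ ≤ bound := by
          simp only [bound, mul_add]
          gcongr
          · exact le_max_left _ _
          · exact le_max_right _ _
  by_cases hb : bound = ∞
  · rw [hb, add_top]; exact le_top
  obtain ⟨U, hU, hUle⟩ := exists_tendsto_of_tsum_distLpNorm_ne_top _ (ne_top_of_le_ne_top hb htot)
  simp_rw [← map_sum, telescope_sum hP, map_sub] at hU
  have h8 : Tendsto (fun N : ℕ => T (P (j - 2 + N)) - T (P (j - 2))) atTop
      (𝓝 (T h - T (P (j - 2)))) := by
    refine Tendsto.sub_const ?_ _
    refine (T.continuous.tendsto h).comp (hlim.comp ?_)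
    exact tendsto_atTop_add_const_left _ _ tendsto_natCast_atTop_atTop
  have h9 : T h = T (P (j - 2)) + U := by
    rw [tendsto_nhds_unique hU h8]; abel
  rw [h9]
  exact (distLpNorm_add_le _ _).trans (add_le_add le_rfl (hUle.trans htot))

end Telescope

/-! ### Spectral localization and paraproduct estimates -/

section Product

variable {χ : Eu d → ℝ}

/-- The product of a dyadic block and a lower frequency part is spectrally localized in an
annulus. -/
theorem IsCutoff.wideAnnulus_mul_eq_self (hχ : IsCutoff χ) {F G : Eu d → ℂ}
    (hF : F.HasTemperateGrowth) (hG : G.HasTemperateGrowth) {u v : 𝓢'(Eu d, ℂ)} {k : ℤ}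
    (hFu : ofFun F = dyadicBlock χ k u) (hGv : ofFun G = lowFreq χ (k - 2) v) :
    fourierMultiplierCLM ℂ (dilate (wideAnnulusSymbol χ) k) (ofFun (F * G)) = ofFun (F * G) := by
  have hκ := (hχ.isSymbol_wideAnnulus.dilated k).hasTemperateGrowth
  rw [dyadicBlock_eq] at hFu
  rw [lowFreq_eq] at hGv
  refine fourierMultiplierCLM_eq_self hκ ?_
  have h1 : (1 : Eu d → ℂ).HasTemperateGrowth := .const 1
  refine fourierMultiplier_ofFun_mul_eq_zero (h1.sub hκ)
    (hχ.isSymbol_annulus.dilated k).hasTemperateGrowth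
    ((hχ.isSymbol one_pos).dilated (k - 2)).hasTemperateGrowth (fun ξ η hξ hη => ?_) hF hG hFu hGv
  simp only [dilate] at hξ hη
  have hξ' := hχ.norm_of_annulus_ne_zero hξ
  have hη' := hχ.norm_le_of_scaledCutoff_ne_zero zero_le_one hη
  have h3 : (2 : ℝ) ^ (-(k - 2)) • η = (4 : ℝ) • ((2 : ℝ) ^ (-k) • η) := by
    rw [smul_smul, neg_sub, sub_eq_add_neg, zpow_add₀ two_ne_zero]
    norm_num
  rw [h3, norm_smul, Real.norm_of_nonneg (by norm_num)] at hη'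
  simp only [Pi.sub_apply, Pi.one_apply, dilate, smul_add]
  set a := (2 : ℝ) ^ (-k) • ξ
  set b := (2 : ℝ) ^ (-k) • η
  have h4 : ‖a‖ - ‖b‖ ≤ ‖a + b‖ := by
    have := norm_sub_norm_le a (-b)
    rwa [norm_neg, sub_neg_eq_add] at this
  have h5 : ‖a + b‖ ≤ ‖a‖ + ‖b‖ := norm_add_le _ _
  -- After rescaling, |a| ∈ [3/4, 8/3] and |b| ≤ 1/3, so |a + b| ∈ [5/12, 3].
  rw [hχ.wideAnnulus_eq_one (by linarith [hξ'.1]) (by linarith [hξ'.2]), sub_self]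

/-- The product of low frequency parts has no high frequencies. -/
theorem IsCutoff.dyadicBlock_mul_lowFreq_eq_zero (hχ : IsCutoff χ) {F G : Eu d → ℂ}
    (hF : F.HasTemperateGrowth) (hG : G.HasTemperateGrowth) {u v : 𝓢'(Eu d, ℂ)} {k : ℤ}
    (hFu : ofFun F = lowFreq χ (k - 2) u) (hGv : ofFun G = lowFreq χ (k - 2) v) :
    dyadicBlock χ k (ofFun (F * G)) = 0 := by
  rw [lowFreq_eq] at hFu hGv
  rw [dyadicBlock_eq]
  have hS := ((hχ.isSymbol one_pos).dilated (k - 2)).hasTemperateGrowth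
  refine fourierMultiplier_ofFun_mul_eq_zero
    (hχ.isSymbol_annulus.dilated k).hasTemperateGrowth hS hS (fun ξ η hξ hη => ?_) hF hG hFu hGv
  simp only [dilate] at hξ hη
  have hξ' := hχ.norm_le_of_scaledCutoff_ne_zero zero_le_one hξ
  have hη' := hχ.norm_le_of_scaledCutoff_ne_zero zero_le_one hη
  have h3 : ∀ η : Eu d, (2 : ℝ) ^ (-(k - 2)) • η = (4 : ℝ) • ((2 : ℝ) ^ (-k) • η) := fun η => by
    rw [smul_smul, neg_sub, sub_eq_add_neg, zpow_add₀ two_ne_zero]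
    norm_num
  rw [h3, norm_smul, Real.norm_of_nonneg (by norm_num)] at hη' hξ'
  simp only [dilate, smul_add]
  -- Each rescaled frequency is at most 1/3, so the sum is at most 2/3 < 3/4.
  by_contra hne
  have h4 := (hχ.norm_of_annulus_ne_zero hne).1
  have h5 := norm_add_le ((2 : ℝ) ^ (-k) • ξ) ((2 : ℝ) ^ (-k) • η)
  linarith

variable {s₁ s₂ : ℝ} {p₁ p₂ : ℝ≥0∞} [Fact (1 ≤ p₁)] [Fact (1 ≤ p₂)]

/-- Hölder, with the supremum over blocks of g and the ℓ¹ sum over blocks of f. Since s₁ + s₂ ≥ 0,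
the weight at j + n is at most the one at j; the index shifts cost only a constant. -/
theorem exists_diagonal_bound (χ : Eu d → ℝ) (s₁ s₂ : ℝ) (hs : 0 ≤ s₁ + s₂) (p₁ p₂ q : ℝ≥0∞)
    [Fact (1 ≤ p₁)] [Fact (1 ≤ p₂)] [Fact (1 ≤ q)] [p₁.HolderTriple p₂ q] :
    ∃ C : ℝ≥0, ∀ (f g : 𝓢'(Eu d, ℂ)) (i₁ i₂ : ℤ) (F G : ℤ → Eu d → ℂ),
      |i₁| ≤ 2 → |i₂| ≤ 2 →
      (∀ k, (F k).HasTemperateGrowth ∧ ofFun (F k) = dyadicBlock χ (k - i₁) f) →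
      (∀ k, (G k).HasTemperateGrowth ∧ ofFun (G k) = dyadicBlock χ (k - i₂) g) → ∀ j : ℤ,
        ∑' n : ℕ, distLpNorm q (ofFun (F (j + n) * G (j + n))) ≤
          C * (besovNorm χ s₁ p₁ 1 f * besovNorm χ s₂ p₂ ∞ g) * 2 ^ (-((j : ℝ) * (s₁ + s₂))) := by
  set c : ℝ≥0 := ((2 : ℝ≥0∞) ^ (2 * |s₁| + 2 * |s₂|)).toNNReal with hc
  have hc' : (c : ℝ≥0∞) = 2 ^ (2 * |s₁| + 2 * |s₂|) := ENNReal.coe_toNNReal (two_rpow_ne_top _)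
  refine ⟨c, fun f g i₁ i₂ F G hi₁ hi₂ hF hG j => ?_⟩
  set B := besovNorm χ s₂ p₂ ∞ g
  let α : ℤ → ℝ≥0∞ := fun k => 2 ^ ((k : ℝ) * s₁) * distLpNorm p₁ (dyadicBlock χ k f)
  have hterm : ∀ n : ℕ, distLpNorm q (ofFun (F (j + n) * G (j + n))) ≤
      c * B * 2 ^ (-((j : ℝ) * (s₁ + s₂))) * α (j + n - i₁) := by
    intro n
    refine (distLpNorm_ofFun_mul_le p₁ p₂ q (hF _).1 (hG _).1).trans ?_
    rw [(hF _).2, (hG _).2]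
    refine (mul_le_mul' le_rfl (distLpNorm_dyadicBlock_le_top (s := s₂) _)).trans ?_
    rw [eq_two_rpow_mul (((j + n - i₁ : ℤ) : ℝ) * s₁) (distLpNorm p₁ _)]
    change _ * α (j + n - i₁) * (_ * B) ≤ _
    have h1 : ∀ x y : ℝ, (2 : ℝ≥0∞) ^ x * α (j + n - i₁) * (2 ^ y * B) =
        2 ^ (x + y) * (α (j + n - i₁) * B) := fun x y => by rw [two_rpow_add]; ring
    have h2 : ∀ x : ℝ, c * B * 2 ^ x * α (j + n - i₁) =
        2 ^ ((2 * |s₁| + 2 * |s₂|) + x) * (α (j + n - i₁) * B) := fun x => by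
      rw [two_rpow_add, hc']; ring
    rw [h1, h2]
    refine mul_le_mul' (two_rpow_le ?_) le_rfl
    have hi₁' : |(i₁ : ℝ)| ≤ 2 := by exact_mod_cast hi₁
    have hi₂' : |(i₂ : ℝ)| ≤ 2 := by exact_mod_cast hi₂
    have h3 : (i₁ : ℝ) * s₁ ≤ 2 * |s₁| := (le_abs_self _).trans (by rw [abs_mul]; gcongr)
    have h4 : (i₂ : ℝ) * s₂ ≤ 2 * |s₂| := (le_abs_self _).trans (by rw [abs_mul]; gcongr)
    have h5 : 0 ≤ (n : ℝ) * (s₁ + s₂) := by positivity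
    push_cast
    linarith
  calc _ ≤ ∑' n : ℕ, c * B * 2 ^ (-((j : ℝ) * (s₁ + s₂))) * α (j + n - i₁) :=
        ENNReal.tsum_le_tsum hterm
    _ = c * B * 2 ^ (-((j : ℝ) * (s₁ + s₂))) * ∑' n : ℕ, α (j + n - i₁) := ENNReal.tsum_mul_left
    _ ≤ c * B * 2 ^ (-((j : ℝ) * (s₁ + s₂))) * besovNorm χ s₁ p₁ 1 f := by
        gcongr
        rw [besovNorm_one]
        exact ENNReal.tsum_comp_le_tsum_of_injective (f := fun n : ℕ => j + (n : ℤ) - i₁)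
          (fun a b h => by simpa using h) α
    _ = _ := by ring

/-- The hypotheses on the exponents. -/
structure Admissible (d : ℕ) (s₁ s₂ : ℝ) (p₁ p₂ : ℝ≥0∞) : Prop where
  add_nonneg : 0 ≤ s₁ + s₂
  le₁ : s₁ ≤ d * (p₁⁻¹).toReal
  lt₁ : s₂ < d * (p₁⁻¹).toReal
  lt₂ : s₂ < d * (p₂⁻¹).toReal

/-- The paraproduct blocks of `g` by `f`. -/
theorem IsCutoff.exists_paraproduct_bound (hχ : IsCutoff χ) (h : Admissible d s₁ s₂ p₁ p₂) :
    ∃ C : ℝ≥0, ∀ f ∈ besovSpace χ s₁ p₁ 1, ∀ g ∈ besovSpace χ s₂ p₂ ∞, ∀ (k : ℤ)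
      (F G : Eu d → ℂ), F.HasTemperateGrowth → G.HasTemperateGrowth →
      ofFun F = lowFreq χ (k - 2) f → ofFun G = dyadicBlock χ k g →
      distLpNorm p₂ (ofFun (F * G)) ≤ C * (besovNorm χ s₁ p₁ 1 f * besovNorm χ s₂ p₂ ∞ g) *
        2 ^ ((k : ℝ) * (d * (p₁⁻¹).toReal - s₁ - s₂)) := by
  obtain ⟨C, hC⟩ := hχ.exists_lowFreq_le_of_one (s := s₁) (p := p₁) (q := ∞) le_top
    (e := d * (p₁⁻¹).toReal - s₁) (by simp) (by linarith [h.le₁])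
  refine ⟨C, fun f hf g hg k F G hF hG hFf hGg => ?_⟩
  refine (distLpNorm_ofFun_mul_le ∞ p₂ p₂ hF hG).trans ?_
  rw [hFf, hGg]
  refine (mul_le_mul' (hC f hf (k - 2)) (distLpNorm_dyadicBlock_le_top (s := s₂) k)).trans ?_
  set A := besovNorm χ s₁ p₁ 1 f
  set B := besovNorm χ s₂ p₂ ∞ g
  have h1 : ∀ x y : ℝ, C * 2 ^ x * A * (2 ^ y * B) = C * (A * B) * 2 ^ (x + y) := fun x y => by
    rw [two_rpow_add]; ring
  rw [h1]
  refine mul_le_mul' le_rfl (two_rpow_le ?_)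
  have := h.le₁
  push_cast
  linarith

/-- The paraproduct blocks of `f` by `g`. -/
theorem IsCutoff.exists_paraproduct_bound' (hχ : IsCutoff χ) (h : Admissible d s₁ s₂ p₁ p₂) :
    ∃ C : ℝ≥0, ∀ f ∈ besovSpace χ s₁ p₁ 1, ∀ g ∈ besovSpace χ s₂ p₂ ∞, ∀ (k : ℤ)
      (F G : Eu d → ℂ), F.HasTemperateGrowth → G.HasTemperateGrowth →
      ofFun F = dyadicBlock χ k f → ofFun G = lowFreq χ (k - 2) g →
      distLpNorm p₂ (ofFun (F * G)) ≤ C * (besovNorm χ s₁ p₁ 1 f * besovNorm χ s₂ p₂ ∞ g) *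
        2 ^ ((k : ℝ) * (d * (p₁⁻¹).toReal - s₁ - s₂)) := by
  have hp₁ : 1 ≤ p₁ := Fact.out
  have hp₂ : 1 ≤ p₂ := Fact.out
  have hpi₂ : p₂⁻¹ ≠ ∞ := ENNReal.inv_ne_top.2 (zero_lt_one.trans_le hp₂).ne'
  -- Hölder needs q₁ ≥ p₂ and Bernstein for f needs q₁ ≥ p₁. For the least such q₁, summing g in
  -- L^{q₂} requires s₂ < d/q₁, which is exactly the minimum hypothesis.
  set q₁ := max p₁ p₂ with hq₁
  set q₂ := (p₂⁻¹ - q₁⁻¹)⁻¹ with hq₂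
  have hle : q₁⁻¹ ≤ p₂⁻¹ := ENNReal.inv_le_inv.2 (le_max_right _ _)
  have : Fact (1 ≤ q₁) := ⟨hp₁.trans (le_max_left _ _)⟩
  have hq₂' : p₂ ≤ q₂ := by
    rw [hq₂, ENNReal.le_inv_iff_le_inv]
    exact tsub_le_self
  have : Fact (1 ≤ q₂) := ⟨hp₂.trans hq₂'⟩
  have : q₁.HolderTriple q₂ p₂ := ⟨by rw [hq₂, inv_inv]; exact add_tsub_cancel_of_le hle⟩
  have hQ₂ : (q₂⁻¹).toReal = (p₂⁻¹).toReal - (q₁⁻¹).toReal := by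
    rw [hq₂, inv_inv, ENNReal.toReal_sub_of_le hle hpi₂]
  have hlt : s₂ < d * (q₁⁻¹).toReal := by
    rcases le_total p₁ p₂ with hle | hle
    · rw [hq₁, max_eq_right hle]; exact h.lt₂
    · rw [hq₁, max_eq_left hle]; exact h.lt₁
  obtain ⟨C, hC1, hC⟩ := hχ.exists_bernstein_dyadicBlock
  obtain ⟨C', hC'⟩ := hχ.exists_lowFreq_le_of_top (s := s₂) hq₂' (e := d * (q₁⁻¹).toReal - s₂)
    (by rw [hQ₂]; ring) (by linarith)
  refine ⟨C * C', fun f hf g hg k F G hF hG hFf hGg => ?_⟩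
  refine (distLpNorm_ofFun_mul_le q₁ q₂ p₂ hF hG).trans ?_
  rw [hFf, hGg]
  refine (mul_le_mul' ((hC p₁ q₁ (le_max_left _ _) k f).trans
    (mul_le_mul' le_rfl (distLpNorm_dyadicBlock_le_one (s := s₁) k))) (hC' g hg (k - 2))).trans ?_
  set A := besovNorm χ s₁ p₁ 1 f
  set B := besovNorm χ s₂ p₂ ∞ g
  have h1 : ∀ x y z : ℝ, C * 2 ^ x * (2 ^ y * A) * (C' * 2 ^ z * B) =
      (C * C' : ℝ≥0) * (A * B) * 2 ^ (x + y + z) := fun x y z => by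
    rw [two_rpow_add, two_rpow_add]; push_cast; ring
  rw [h1]
  refine mul_le_mul' le_rfl (two_rpow_le ?_)
  push_cast
  linarith

end Product

/-! ### Bony's decomposition -/

section Decomposition

variable {χ : Eu d → ℝ} {s₁ s₂ : ℝ} {p₁ p₂ : ℝ≥0∞} [Fact (1 ≤ p₁)] [Fact (1 ≤ p₂)]

/-- Bony's decomposition of the increments of the products of low frequency parts into
spectrally localized paraproduct blocks and a diagonal part. -/
theorem IsCutoff.exists_decomposition (hχ : IsCutoff χ) (h : Admissible d s₁ s₂ p₁ p₂) (q : ℝ≥0∞)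
    [Fact (1 ≤ q)] [p₁.HolderTriple p₂ q] :
    ∃ C : ℝ≥0, ∀ f ∈ besovSpace χ s₁ p₁ 1, ∀ g ∈ besovSpace χ s₂ p₂ ∞, ∀ F G : ℤ → Eu d → ℂ,
      (∀ k, (F k).HasTemperateGrowth ∧ ofFun (F k) = lowFreq χ k f) →
      (∀ k, (G k).HasTemperateGrowth ∧ ofFun (G k) = lowFreq χ k g) →
      ∃ W D : ℤ → 𝓢'(Eu d, ℂ),
        (∀ k, ofFun (F (k + 1) * G (k + 1)) = ofFun (F k * G k) + (W k + D k)) ∧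
        (∀ k, fourierMultiplierCLM ℂ (dilate (wideAnnulusSymbol χ) k) (W k) = W k) ∧
        (∀ k : ℤ, distLpNorm p₂ (W k) ≤
          C * (besovNorm χ s₁ p₁ 1 f * besovNorm χ s₂ p₂ ∞ g) *
            2 ^ ((k : ℝ) * (d * (p₁⁻¹).toReal - s₁ - s₂))) ∧
        ∀ j : ℤ, ∑' n : ℕ, distLpNorm q (D (j + n)) ≤
          C * (besovNorm χ s₁ p₁ 1 f * besovNorm χ s₂ p₂ ∞ g) *
            2 ^ (-((j : ℝ) * (s₁ + s₂))) := by
  obtain ⟨C₁, hC₁⟩ := hχ.exists_paraproduct_bound h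
  obtain ⟨C₂, hC₂⟩ := hχ.exists_paraproduct_bound' h
  obtain ⟨C₃, hC₃⟩ := exists_diagonal_bound χ s₁ s₂ h.add_nonneg p₁ p₂ q
  refine ⟨max (C₁ + C₂) (5 * C₃), fun f hf g hg F G hF hG => ?_⟩
  have hblock : ∀ {u : 𝓢'(Eu d, ℂ)} {H : ℤ → Eu d → ℂ},
      (∀ k, (H k).HasTemperateGrowth ∧ ofFun (H k) = lowFreq χ k u) → ∀ k,
        (H (k + 1) - H k).HasTemperateGrowth ∧
          ofFun (H (k + 1) - H k) = dyadicBlock χ k u := fun hH k => by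
    refine ⟨(hH _).1.sub (hH _).1, ?_⟩
    rw [ofFun_sub (hH _).1 (hH _).1, (hH _).2, (hH _).2, hχ.dyadicBlock_eq_sub]
  let a : ℤ → Eu d → ℂ := fun k => F (k + 1) - F k
  let b : ℤ → Eu d → ℂ := fun k => G (k + 1) - G k
  have ha : ∀ k, (a k).HasTemperateGrowth ∧ ofFun (a k) = dyadicBlock χ k f := hblock hF
  have hb : ∀ k, (b k).HasTemperateGrowth ∧ ofFun (b k) = dyadicBlock χ k g := hblock hG
  -- F_{k+1}G_{k+1} − F_kG_k = F_k b_k + a_k G_k + a_k b_k; then F_k = F_{k−2} + a_{k−2} + a_{k−1}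
  -- is inserted, and likewise for G_k.
  refine ⟨fun k => ofFun (F (k - 2) * b k) + ofFun (a k * G (k - 2)),
    fun k => ofFun (a k * b (k - 2)) + ofFun (a k * b (k - 1)) + ofFun (a (k - 2) * b k) +
      ofFun (a (k - 1) * b k) + ofFun (a k * b k), fun k => ?_, fun k => ?_, fun k => ?_,
    fun j => ?_⟩
  · have haF : ∀ i j, (F i * b j).HasTemperateGrowth := fun i j => (hF i).1.mul (hb j).1
    have haG : ∀ i j, (a i * G j).HasTemperateGrowth := fun i j => (ha i).1.mul (hG j).1
    have hab : ∀ i j, (a i * b j).HasTemperateGrowth := fun i j => (ha i).1.mul (hb j).1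
    beta_reduce
    rw [← ofFun_add (haF _ _) (haG _ _), ← ofFun_add (hab _ _) (hab _ _),
      ← ofFun_add ((hab _ _).add (hab _ _)) (hab _ _),
      ← ofFun_add (((hab _ _).add (hab _ _)).add (hab _ _)) (hab _ _),
      ← ofFun_add ((((hab _ _).add (hab _ _)).add (hab _ _)).add (hab _ _)) (hab _ _),
      ← ofFun_add ((haF _ _).add (haG _ _))
        (((((hab _ _).add (hab _ _)).add (hab _ _)).add (hab _ _)).add (hab _ _)),
      ← ofFun_add ((hF k).1.mul (hG k).1) (((haF _ _).add (haG _ _)).add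
        (((((hab _ _).add (hab _ _)).add (hab _ _)).add (hab _ _)).add (hab _ _)))]
    congr 1
    simp only [a, b, show k - 2 + 1 = k - 1 by ring, show k - 1 + 1 = k by ring]
    ring
  · beta_reduce
    rw [map_add, mul_comm (F (k - 2)),
      hχ.wideAnnulus_mul_eq_self (hb k).1 (hF _).1 (hb k).2 (hF _).2,
      hχ.wideAnnulus_mul_eq_self (ha k).1 (hG _).1 (ha k).2 (hG _).2]
  · refine (distLpNorm_add_le _ _).trans ((add_le_add
      (hC₁ f hf g hg k _ _ (hF _).1 (hb k).1 (hF _).2 (hb k).2)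
      (hC₂ f hf g hg k _ _ (ha k).1 (hG _).1 (ha k).2 (hG _).2)).trans ?_)
    rw [← add_mul, ← add_mul, ← ENNReal.coe_add]
    gcongr
    exact le_max_left _ _
  · have hshift : ∀ {u : 𝓢'(Eu d, ℂ)} {H : ℤ → Eu d → ℂ},
        (∀ k, (H k).HasTemperateGrowth ∧ ofFun (H k) = dyadicBlock χ k u) → ∀ i k : ℤ,
          (H (k - i)).HasTemperateGrowth ∧ ofFun (H (k - i)) = dyadicBlock χ (k - i) u :=
      fun hH i k => hH _
    have key := fun (i₁ i₂ : ℤ) (h₁ : |i₁| ≤ 2) (h₂ : |i₂| ≤ 2) =>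
      hC₃ f g i₁ i₂ _ _ h₁ h₂ (hshift ha i₁) (hshift hb i₂) j
    have k1 := key 0 2 (by simp) (by simp)
    have k2 := key 0 1 (by simp) (by simp)
    have k3 := key 2 0 (by simp) (by simp)
    have k4 := key 1 0 (by simp) (by simp)
    have k5 := key 0 0 (by simp) (by simp)
    simp only [sub_zero] at k1 k2 k3 k4 k5
    set M := (C₃ : ℝ≥0∞) * (besovNorm χ s₁ p₁ 1 f * besovNorm χ s₂ p₂ ∞ g) *
      2 ^ (-((j : ℝ) * (s₁ + s₂))) with hM
    calc _ ≤ M + M + M + M + M := by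
          refine le_trans ?_ (add_le_add (add_le_add (add_le_add (add_le_add k1 k2) k3) k4) k5)
          rw [← ENNReal.tsum_add, ← ENNReal.tsum_add, ← ENNReal.tsum_add, ← ENNReal.tsum_add]
          exact ENNReal.tsum_le_tsum fun n =>
            (distLpNorm_add_le _ _).trans (add_le_add ((distLpNorm_add_le _ _).trans
              (add_le_add ((distLpNorm_add_le _ _).trans (add_le_add (distLpNorm_add_le _ _)
              le_rfl)) le_rfl)) le_rfl)
      _ = (5 * C₃ : ℝ≥0) * (besovNorm χ s₁ p₁ 1 f * besovNorm χ s₂ p₂ ∞ g) *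
          2 ^ (-((j : ℝ) * (s₁ + s₂))) := by
          rw [hM]; push_cast; ring
      _ ≤ _ := by
          gcongr
          exact le_max_right _ _

theorem tendsto_two_rpow_atBot {ε : ℝ} (hε : 0 < ε) :
    Tendsto (fun j : ℤ => (2 : ℝ≥0∞) ^ ((j : ℝ) * ε)) atBot (𝓝 0) := by
  have h1 : Tendsto (fun j : ℤ => (j : ℝ) * ε) atBot atBot :=
    (tendsto_intCast_atBot_iff.2 tendsto_id).atBot_mul_const hε
  have h2 : Tendsto (fun x : ℝ => (2 : ℝ) ^ x) atBot (𝓝 0) :=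
    tendsto_rpow_atBot_of_base_gt_one 2 one_lt_two
  have h3 := ENNReal.tendsto_ofReal (h2.comp h1)
  rw [ENNReal.ofReal_zero] at h3
  refine h3.congr fun j => ?_
  simp only [Function.comp_apply]
  rw [← ENNReal.ofReal_rpow_of_pos (by norm_num)]
  simp

/-- Products of low frequency parts are bounded. -/
theorem IsCutoff.exists_lowFreq_mul_bound (hχ : IsCutoff χ) (h : Admissible d s₁ s₂ p₁ p₂) :
    ∃ C : ℝ≥0, ∀ f ∈ besovSpace χ s₁ p₁ 1, ∀ g ∈ besovSpace χ s₂ p₂ ∞, ∀ (k : ℤ)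
      (F G : Eu d → ℂ), F.HasTemperateGrowth → G.HasTemperateGrowth →
      ofFun F = lowFreq χ (k - 2) f → ofFun G = lowFreq χ (k - 2) g →
      distLpNorm ∞ (ofFun (F * G)) ≤ C * (besovNorm χ s₁ p₁ 1 f * besovNorm χ s₂ p₂ ∞ g) *
        2 ^ ((k : ℝ) * (d * (p₁⁻¹).toReal + d * (p₂⁻¹).toReal - s₁ - s₂)) := by
  obtain ⟨C₁, hC₁⟩ := hχ.exists_lowFreq_le_of_one (s := s₁) (p := p₁) (q := ∞) le_top
    (e := d * (p₁⁻¹).toReal - s₁) (by simp) (by linarith [h.le₁])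
  obtain ⟨C₂, hC₂⟩ := hχ.exists_lowFreq_le_of_top (s := s₂) (p := p₂) (q := ∞) le_top
    (e := d * (p₂⁻¹).toReal - s₂) (by simp) (by linarith [h.lt₂])
  refine ⟨C₁ * C₂, fun f hf g hg k F G hF hG hFf hGg => ?_⟩
  refine (distLpNorm_ofFun_mul_le ∞ ∞ ∞ hF hG).trans ?_
  rw [hFf, hGg]
  refine (mul_le_mul' (hC₁ f hf (k - 2)) (hC₂ g hg (k - 2))).trans ?_
  set A := besovNorm χ s₁ p₁ 1 f
  set B := besovNorm χ s₂ p₂ ∞ g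
  have h1 : ∀ x y : ℝ, C₁ * 2 ^ x * A * (C₂ * 2 ^ y * B) =
      (C₁ * C₂ : ℝ≥0) * (A * B) * 2 ^ (x + y) := fun x y => by
    rw [two_rpow_add]; push_cast; ring
  rw [h1]
  refine mul_le_mul' le_rfl (two_rpow_le ?_)
  have := h.le₁
  have := h.lt₂
  push_cast
  linarith

end Decomposition

end HomBesov

end

/-! ### Existence of the product and its Besov bound -/

theorem proposition5p1 (d : ℕ) (hd : 1 ≤ d)
    (χ : HomBesov.Eu d → ℝ) (hχ : HomBesov.IsCutoff χ)
    (s₁ s₂ : ℝ) (p₁ p₂ : ℝ≥0∞) [Fact (1 ≤ p₁)] [Fact (1 ≤ p₂)]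
    (hs : 0 ≤ s₁ + s₂)
    (hs₁ : s₁ ≤ d * (p₁⁻¹).toReal)
    (hs₂ : s₂ < min (d * (p₁⁻¹).toReal) (d * (p₂⁻¹).toReal))
    (hp : p₁⁻¹ + p₂⁻¹ ≤ 1) :
    ∃ C : ℝ≥0, ∀ f ∈ HomBesov.besovSpace χ s₁ p₁ 1, ∀ g ∈ HomBesov.besovSpace χ s₂ p₂ ∞,
      ∃ h : 𝓢'(HomBesov.Eu d, ℂ), HomBesov.IsProduct χ f g h ∧
        h ∈ HomBesov.besovSpace χ (s₁ + s₂ - d * (p₁⁻¹).toReal) p₂ ∞ ∧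
        HomBesov.besovNorm χ (s₁ + s₂ - d * (p₁⁻¹).toReal) p₂ ∞ h ≤
          C * (HomBesov.besovNorm χ s₁ p₁ 1 f * HomBesov.besovNorm χ s₂ p₂ ∞ g) := by
  open HomBesov in
  have hadm : Admissible d s₁ s₂ p₁ p₂ :=
    ⟨hs, hs₁, hs₂.trans_le (min_le_left _ _), hs₂.trans_le (min_le_right _ _)⟩
  have hp₁ : 1 ≤ p₁ := Fact.out
  have hp₂ : 1 ≤ p₂ := Fact.out
  have hpi₁ : p₁⁻¹ ≠ ∞ := ENNReal.inv_ne_top.2 (zero_lt_one.trans_le hp₁).ne'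
  have hpi₂ : p₂⁻¹ ≠ ∞ := ENNReal.inv_ne_top.2 (zero_lt_one.trans_le hp₂).ne'
  -- The Hölder exponent of the diagonal part; `hp` says precisely that q ≥ 1.
  set q := (p₁⁻¹ + p₂⁻¹)⁻¹ with hq
  have : Fact (1 ≤ q) := ⟨by rw [hq, ENNReal.le_inv_iff_le_inv, inv_one]; exact hp⟩
  have : p₁.HolderTriple p₂ q := ⟨by rw [hq, inv_inv]⟩
  have hqp : q ≤ p₂ := by rw [hq, ENNReal.inv_le_iff_inv_le]; exact le_add_self
  have hQ : (q⁻¹).toReal = (p₁⁻¹).toReal + (p₂⁻¹).toReal := by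
    rw [hq, inv_inv, ENNReal.toReal_add hpi₁ hpi₂]
  obtain ⟨C₁, hC₁⟩ := hχ.exists_lowFreq_le_of_one (s := s₁) (p := p₁) (q := ∞) le_top
    (e := d * (p₁⁻¹).toReal - s₁) (by simp) (by linarith [hadm.le₁])
  obtain ⟨C₂, hC₂⟩ := hχ.exists_lowFreq_le_of_top (s := s₂) (p := p₂) (q := ∞) le_top
    (e := d * (p₂⁻¹).toReal - s₂) (by simp) (by linarith [hadm.lt₂])
  obtain ⟨C₃, hC₃⟩ := hχ.exists_decomposition hadm q
  obtain ⟨C₄, hC₄⟩ := hχ.exists_lowFreq_mul_bound hadm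
  have hχ0 : ∀ ξ : Eu d, 8 / 3 < ‖ξ‖ → scaledCutoff χ 1 ξ = 0 := fun ξ hξ =>
    hχ.scaledCutoff_eq_zero zero_le_one (by linarith)
  have hφ0 : ∀ ξ : Eu d, 8 / 3 < ‖ξ‖ → annulusSymbol χ ξ = 0 := fun ξ hξ => by
    by_contra hne
    exact absurd (hχ.norm_of_annulus_ne_zero hne).2 (not_le.2 hξ)
  have hκ0 : ∀ ξ : Eu d, ‖ξ‖ < 3 / 16 → wideAnnulusSymbol χ ξ = 0 := fun ξ hξ => by
    by_contra hne
    exact absurd (hχ.norm_of_wideAnnulus_ne_zero hne) (not_le.2 hξ)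
  obtain ⟨C₅, hC₅⟩ := (hχ.isSymbol one_pos).exists_telescope_bound hχ.isSymbol_wideAnnulus hχ0 hκ0
    p₂ q ∞ le_top le_top (d * (p₁⁻¹).toReal - s₁ - s₂) (s₁ + s₂)
  obtain ⟨C₆, hC₆⟩ := hχ.isSymbol_annulus.exists_telescope_bound hχ.isSymbol_wideAnnulus hφ0 hκ0
    p₂ q p₂ le_rfl hqp (d * (p₁⁻¹).toReal - s₁ - s₂) (s₁ + s₂)
  obtain ⟨C₇, -, hC₇⟩ := (hχ.isSymbol one_pos).exists_bernstein
  -- The factor 2 counts the paraproduct and diagonal parts, both bounded with `C₃`.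
  refine ⟨C₆ * (2 * C₃), fun f hf g hg => ?_⟩
  set A := besovNorm χ s₁ p₁ 1 f
  set B := besovNorm χ s₂ p₂ ∞ g
  have hA : A ≠ ∞ := hf.2.ne
  have hB : B ≠ ∞ := hg.2.ne
  obtain ⟨F, hF⟩ := hχ.exists_ofFun_eq_lowFreq (u := f) fun k =>
    ne_top_of_le_ne_top (ENNReal.mul_ne_top (ENNReal.mul_ne_top ENNReal.coe_ne_top
      (two_rpow_ne_top _)) hA) (hC₁ f hf k)
  obtain ⟨G, hG⟩ := hχ.exists_ofFun_eq_lowFreq (u := g) fun k =>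
    ne_top_of_le_ne_top (ENNReal.mul_ne_top (ENNReal.mul_ne_top ENNReal.coe_ne_top
      (two_rpow_ne_top _)) hB) (hC₂ g hg k)
  obtain ⟨W, D, hP, hW, hWX, hD⟩ := hC₃ f hf g hg F G hF hG
  have hX : (C₃ : ℝ≥0∞) * (A * B) ≠ ∞ :=
    ENNReal.mul_ne_top ENNReal.coe_ne_top (ENNReal.mul_ne_top hA hB)
  obtain ⟨h, hlim⟩ := exists_tendsto_of_telescope (P := fun k => ofFun (F k * G k)) hP
    hχ.isSymbol_wideAnnulus (ρ := 3 / 16) (by norm_num) hκ0 p₂ q hW hX hWX (by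
      have := hD 0
      simp only [zero_add] at this
      exact ne_top_of_le_ne_top (ENNReal.mul_ne_top hX (two_rpow_ne_top _)) this)
  have hbesov : besovNorm χ (s₁ + s₂ - d * (p₁⁻¹).toReal) p₂ ∞ h ≤
      (C₆ * (2 * C₃) : ℝ≥0) * (A * B) := by
    refine besovNorm_top_le fun j => ?_
    have h1 := hC₆ _ W D h _ _ hP hW hWX hD hlim j
    -- The starting term P_{j−2} vanishes under Δ̇_j. Both remaining exponents equal σ, since
    -- Bernstein from L^q to L^{p₂} gains d/p₁.
    rw [← dyadicBlock_eq, ← dyadicBlock_eq, hχ.dyadicBlock_mul_lowFreq_eq_zero (hF _).1 (hG _).1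
      (hF _).2 (hG _).2, distLpNorm_zero, zero_add, hQ,
      show (d : ℝ) * ((p₂⁻¹).toReal - (p₂⁻¹).toReal) + (d * (p₁⁻¹).toReal - s₁ - s₂) =
        -(s₁ + s₂ - d * (p₁⁻¹).toReal) by ring,
      show (d : ℝ) * ((p₁⁻¹).toReal + (p₂⁻¹).toReal - (p₂⁻¹).toReal) - (s₁ + s₂) =
        -(s₁ + s₂ - d * (p₁⁻¹).toReal) by ring] at h1
    refine (mul_le_mul' le_rfl h1).trans (le_of_eq ?_)
    have h2 : (2 : ℝ≥0∞) ^ ((j : ℝ) * (s₁ + s₂ - d * (p₁⁻¹).toReal)) *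
        2 ^ ((j : ℝ) * -(s₁ + s₂ - d * (p₁⁻¹).toReal)) = 1 := by
      rw [← two_rpow_add, mul_neg, add_neg_cancel, ENNReal.rpow_zero]
    set x := (2 : ℝ≥0∞) ^ ((j : ℝ) * (s₁ + s₂ - d * (p₁⁻¹).toReal))
    set y := (2 : ℝ≥0∞) ^ ((j : ℝ) * -(s₁ + s₂ - d * (p₁⁻¹).toReal))
    calc _ = x * y * (C₆ * (2 * C₃) * (A * B)) := by ring
      _ = _ := by rw [h2, one_mul]; push_cast; rfl
  refine ⟨h, ⟨F, G, fun N => (hF N).1, fun N => (hG N).1, fun N => ?_, fun N => ?_, ?_⟩,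
    ⟨?_, hbesov.trans_lt ?_⟩, hbesov⟩
  · rw [← ofFun_eq, (hF N).2]
  · rw [← ofFun_eq, (hG N).2]
  · exact hlim.congr fun N => ofFun_eq _
  · set ε := (d : ℝ) * (p₁⁻¹).toReal + d * (p₂⁻¹).toReal - s₁ - s₂ with hε
    -- Strict because s₁ ≤ d/p₁ and s₂ < d/p₂; this is what places h in 𝓢'_0.
    have hε0 : 0 < ε := by linarith [hadm.le₁, hadm.lt₂]
    have hbd : ∀ j : ℤ, distLpNorm ∞ (lowFreq χ j h) ≤
        (C₇ * (C₄ * (A * B)) + C₅ * (C₃ * (A * B) + C₃ * (A * B))) * 2 ^ ((j : ℝ) * ε) := by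
      intro j
      have h1 := hC₅ _ W D h _ _ hP hW hWX hD hlim j
      have h2 := (hC₇ ∞ ∞ le_rfl j _).trans (mul_le_mul' le_rfl
        (hC₄ f hf g hg j _ _ (hF _).1 (hG _).1 (hF _).2 (hG _).2))
      rw [sub_self, mul_zero, mul_zero, ENNReal.rpow_zero, mul_one] at h2
      rw [lowFreq_eq]
      refine (h1.trans (add_le_add h2 le_rfl)).trans (le_of_eq ?_)
      rw [hQ, ENNReal.inv_top, ENNReal.toReal_zero, sub_zero, sub_zero,
        show (d : ℝ) * (p₂⁻¹).toReal + (d * (p₁⁻¹).toReal - s₁ - s₂) = ε by rw [hε]; ring,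
        show (d : ℝ) * ((p₁⁻¹).toReal + (p₂⁻¹).toReal) - (s₁ + s₂) = ε by rw [hε]; ring]
      ring
    have hfin : (C₇ * (C₄ * (A * B)) + C₅ * (C₃ * (A * B) + C₃ * (A * B)) : ℝ≥0∞) ≠ ∞ := by
      have hAB : A * B ≠ ∞ := ENNReal.mul_ne_top hA hB
      finiteness
    have hlim0 := ENNReal.Tendsto.const_mul (tendsto_two_rpow_atBot hε0) (Or.inr hfin)
    rw [mul_zero] at hlim0
    exact tendsto_of_tendsto_of_tendsto_of_le_of_le tendsto_const_nhds hlim0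
      (fun _ => zero_le) hbd
  · exact ENNReal.mul_lt_top ENNReal.coe_lt_top (ENNReal.mul_ne_top hA hB).lt_top
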